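/- Fix an even, smooth function $\eta:\mathbb R\to[0,1]$, non-increasing in $|x|$, with $\eta(x)=0$ for $|x|>8/5$ and $\eta(x)=1$ for $|x|\le 5/4$. For $k\in\mathbb Z$ put $\chi_k(r)=\eta(r/2^k)-\eta(r/2^{k-1})$ and let $P_k$ be the Littlewood–Paley projector on $L^2(\mathbb R^2)$ with $\widehat{P_ku}(\xi)=\chi_k(|\xi|)\hat u(\xi)$; let $e^{it\Delta}$ be the Schrödinger propagator, with symbol $e^{-it|\xi|^2}$ (here $\hat u(\xi)=\int e^{-ix\cdot\xi}u(x)\,dx$). For $F:\mathbb R^2\times\mathbb R\to\mathbb C$ and $A_\theta$ the rotation of $\mathbb R^2$ by the angle $\theta$ put $$\|F\|_{L^2_{x_1}L^\infty_{x_2,t}}=\Big(\int_{\mathbb R}\operatorname*{ess\,sup}_{(x_2,t)\in\mathbb R^2}|F(x_1,x_2,t)|^2\,dx_1\Big)^{1/2},$$ $$\|F\|_{L^2_{x_1}L^\infty_{x_2,t}L^2_\theta}=\Big(\int_{\mathbb R}\operatorname*{ess\,sup}_{(x_2,t)\in\mathbb R^2}\int_0^{2\pi}|F(A_\theta(x_1,x_2),t)|^2\,d\theta\,dx_1\Big)^{1/2}.$$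 (1) There is a constant $C>0$ (depending only on $\eta$) such that for all $k\in\mathbb Z$ and all $u_0\in L^2(\mathbb R^2)$ $$\|e^{it\Delta}P_ku_0\|_{L^2_{x_1}L^\infty_{x_2,t}L^2_\theta}\le C\,2^{k/2}\,\|u_0\|_{L^2}.$$ (2) The estimate without the angular average fails: for every $k\in\mathbb Z$ and every $C\in\mathbb R$ there is $u_0\in L^2(\mathbb R^2)$ with $$\|e^{it\Delta}P_ku_0\|_{L^2_{x_1}L^\infty_{x_2,t}}> C\,2^{k/2}\,\|u_0\|_{L^2}.$$ -/

import Mathlib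

open MeasureTheory Real Set FourierTransform
open scoped ENNReal ContDiff

noncomputable section

/-- The plane `ℝ²` with its Euclidean norm and Lebesgue measure. -/
abbrev Plane : Type := EuclideanSpace ℝ (Fin 2)

/-- The complex Hilbert space `L²(ℝ²)`. -/
abbrev L2Plane : Type := Lp (α := Plane) ℂ 2 volume

/-- A Littlewood-Paley bump: an even, `[0,1]`-valued, smooth function on `ℝ`, decreasing in `|x|`,
vanishing for `|x| > 8/5` and equal to `1` for `|x| ≤ 5/4`. -/
structure LPBump where
  toFun : ℝ → ℝ
  smooth : ContDiff ℝ ∞ toFun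
  even : ∀ x, toFun (-x) = toFun x
  nonneg : ∀ x, 0 ≤ toFun x
  le_one : ∀ x, toFun x ≤ 1
  antitoneOn : AntitoneOn toFun (Ici 0)
  eq_zero : ∀ x, 8 / 5 < |x| → toFun x = 0
  eq_one : ∀ x, |x| ≤ 5 / 4 → toFun x = 1

/-- The dyadic cutoff `χ_k(r) = η(r / 2^k) - η(r / 2^(k-1))`. -/
def LPBump.chi (η : LPBump) (k : ℤ) (r : ℝ) : ℝ :=
  η.toFun (r / 2 ^ k) - η.toFun (r / 2 ^ (k - 1))

/-- The symbol of `P_k`. Mathlib's Fourier transform has the phase `e^{-2πi x·ξ}`, so that the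
angular frequency is `2πξ`. -/
def lpSymbol (η : LPBump) (k : ℤ) (ξ : Plane) : ℂ :=
  (η.chi k (2 * π * ‖ξ‖) : ℂ)

/-- The symbol of `e^{itΔ}`, that is `e^{-it|2πξ|²}`. -/
def schrodingerSymbol (t : ℝ) (ξ : Plane) : ℂ :=
  Complex.exp (-(Complex.I * (t : ℂ) * ((2 * π * ‖ξ‖ : ℝ) : ℂ) ^ 2))

/-- The function `(x, t) ↦ (e^{itΔ} P_k u₀)(x)` on `ℝ² × ℝ`, written as the inverse Fourier
integral of the (compactly supported, integrable) function `e^{-it|2πξ|²} χ_k(|2πξ|) û₀(ξ)`, where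
`û₀` is the `L²` Fourier transform of `u₀`. See `freeEvolution_ae_eq` for its relation to the
operators on `L²`. -/
def freeEvolution (η : LPBump) (k : ℤ) (u₀ : L2Plane) (x : Plane) (t : ℝ) : ℂ :=
  𝓕⁻ (fun ξ : Plane ↦ schrodingerSymbol t ξ * lpSymbol η k ξ * (𝓕 u₀ : L2Plane) ξ) x

/-- The rotation `A_θ` of the plane. -/
def planeRotation (θ : ℝ) (x : Plane) : Plane :=
  !₂[cos θ * x 0 - sin θ * x 1, sin θ * x 0 + cos θ * x 1]

/-- The angular norm `(x, t) ↦ ‖F(A_θ x, t)‖_{L^r_θ}` over `θ ∈ (0, 2π]`. -/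
def angularNorm (r : ℝ≥0∞) (F : Plane → ℝ → ℂ) (x : Plane) (t : ℝ) : ℝ≥0∞ :=
  eLpNorm (fun θ : ℝ ↦ F (planeRotation θ x) t) r (volume.restrict (Ioc 0 (2 * π)))

/-- The anisotropic norm `L^p_{x₁} L^q_{x₂,t}` of a function of `(x, t) ∈ ℝ² × ℝ`. -/
def anisotropicNorm {E : Type*} [ENorm E] (p q : ℝ≥0∞) (F : Plane → ℝ → E) : ℝ≥0∞ :=
  eLpNorm (fun x₁ : ℝ ↦
    eLpNorm (fun z : ℝ × ℝ ↦ F !₂[x₁, z.1] z.2) q volume) p volume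

/-! The operators `P_k` and `e^{itΔ}` on `L²(ℝ²)`. -/

/-- The Fourier multiplier on `L²(ℝ²)` with a bounded measurable symbol. -/
def fourierMultiplier (m : Plane → ℂ) (hm : MemLp m ∞ volume) (f : L2Plane) : L2Plane :=
  𝓕⁻ ((hm.toLp m • (𝓕 f : L2Plane) : L2Plane))

theorem continuous_lpSymbol (η : LPBump) (k : ℤ) : Continuous (lpSymbol η k) := by
  have h := η.smooth.continuous
  unfold lpSymbol LPBump.chi
  fun_prop

theorem continuous_schrodingerSymbol (t : ℝ) : Continuous (schrodingerSymbol t) := by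
  unfold schrodingerSymbol
  fun_prop

theorem norm_lpSymbol_le (η : LPBump) (k : ℤ) (ξ : Plane) : ‖lpSymbol η k ξ‖ ≤ 1 := by
  rw [lpSymbol, LPBump.chi, Complex.norm_real, Real.norm_eq_abs, abs_le]
  constructor <;>
  linarith [η.nonneg (2 * π * ‖ξ‖ / 2 ^ k), η.le_one (2 * π * ‖ξ‖ / 2 ^ k),
    η.nonneg (2 * π * ‖ξ‖ / 2 ^ (k - 1)), η.le_one (2 * π * ‖ξ‖ / 2 ^ (k - 1))]

theorem norm_schrodingerSymbol (t : ℝ) (ξ : Plane) : ‖schrodingerSymbol t ξ‖ = 1 := by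
  have : -(Complex.I * (t : ℂ) * ((2 * π * ‖ξ‖ : ℝ) : ℂ) ^ 2)
      = ((-(t * (2 * π * ‖ξ‖) ^ 2) : ℝ) : ℂ) * Complex.I := by push_cast; ring
  rw [schrodingerSymbol, this, Complex.norm_exp_ofReal_mul_I]

theorem memLp_lpSymbol (η : LPBump) (k : ℤ) : MemLp (lpSymbol η k) ∞ volume :=
  memLp_top_of_bound (continuous_lpSymbol η k).aestronglyMeasurable 1
    (.of_forall (norm_lpSymbol_le η k))

theorem memLp_schrodingerSymbol (t : ℝ) : MemLp (schrodingerSymbol t) ∞ volume :=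
  memLp_top_of_bound (continuous_schrodingerSymbol t).aestronglyMeasurable 1
    (.of_forall fun ξ ↦ (norm_schrodingerSymbol t ξ).le)

/-- The Littlewood-Paley projector `P_k` on `L²(ℝ²)`. -/
def lpProjector (η : LPBump) (k : ℤ) : L2Plane → L2Plane :=
  fourierMultiplier (lpSymbol η k) (memLp_lpSymbol η k)

/-- The Schrödinger propagator `e^{itΔ}` on `L²(ℝ²)`. -/
def schrodingerPropagator (t : ℝ) : L2Plane → L2Plane :=
  fourierMultiplier (schrodingerSymbol t) (memLp_schrodingerSymbol t)

theorem lpSymbol_eq_zero (η : LPBump) (k : ℤ) (ξ : Plane)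
    (h : (2 : ℝ) ^ k * 2 < 2 * π * ‖ξ‖) : lpSymbol η k ξ = 0 := by
  have h2 : (0 : ℝ) < 2 ^ k := by positivity
  have h0 : 0 ≤ 2 * π * ‖ξ‖ := by positivity
  have e : (2 : ℝ) ^ (k - 1) = 2 ^ k / 2 := by rw [zpow_sub_one₀ two_ne_zero]; ring
  have a : (2 : ℝ) < 2 * π * ‖ξ‖ / 2 ^ k := by rw [lt_div_iff₀ h2]; linarith
  have b : (2 : ℝ) < 2 * π * ‖ξ‖ / 2 ^ (k - 1) := by
    rw [e, lt_div_iff₀ (by positivity)]; linarith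
  rw [lpSymbol, LPBump.chi, η.eq_zero _ (by rw [abs_of_pos (by linarith)]; linarith),
    η.eq_zero _ (by rw [abs_of_pos (by linarith)]; linarith)]
  simp

theorem hasCompactSupport_lpSymbol (η : LPBump) (k : ℤ) : HasCompactSupport (lpSymbol η k) := by
  refine HasCompactSupport.intro (isCompact_closedBall (0 : Plane) ((2 : ℝ) ^ k * 2)) ?_
  intro ξ hξ
  apply lpSymbol_eq_zero
  rw [mem_closedBall_zero_iff, not_le] at hξ
  nlinarith [Real.pi_gt_three, norm_nonneg ξ]

theorem memLp_two_evolutionSymbol (η : LPBump) (k : ℤ) (t : ℝ) :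
    MemLp (fun ξ ↦ schrodingerSymbol t ξ * lpSymbol η k ξ) 2 (volume : Measure Plane) :=
  ((continuous_schrodingerSymbol t).mul (continuous_lpSymbol η k)).memLp_of_hasCompactSupport
    (hasCompactSupport_lpSymbol η k).mul_left

theorem integrable_evolutionSymbol (η : LPBump) (k : ℤ) (u₀ : L2Plane) (t : ℝ) :
    Integrable (fun ξ : Plane ↦
      schrodingerSymbol t ξ * lpSymbol η k ξ * (𝓕 u₀ : L2Plane) ξ) volume :=
  (memLp_two_evolutionSymbol η k t).integrable_mul (Lp.memLp (𝓕 u₀ : L2Plane))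

/-- The `L²` inverse Fourier transform of an integrable function is its inverse Fourier integral. -/
theorem fourierInv_ae_eq (g : L2Plane) (h : Plane → ℂ) (hg : g =ᵐ[volume] h)
    (hh : Integrable h volume) : (𝓕⁻ g : L2Plane) =ᵐ[volume] 𝓕⁻ h := by
  have hc : Continuous (𝓕⁻ h : Plane → ℂ) :=
    VectorFourier.fourierIntegral_continuous (L := -innerₗ Plane) Real.continuous_fourierChar
      (by simpa using! continuous_inner.neg) hh
  refine ae_eq_of_integral_contDiff_smul_eq ((Lp.memLp _).locallyIntegrable one_le_two)
    hc.locallyIntegrable ?_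
  intro φ φ_smooth φ_cpt
  have h₁ : HasCompactSupport (Complex.ofRealCLM ∘ φ) := φ_cpt.comp_left rfl
  have h₂ : ContDiff ℝ ∞ (Complex.ofRealCLM ∘ φ) := by fun_prop
  let ψ : SchwartzMap Plane ℂ := h₁.toSchwartzMap h₂
  have hψ (x : Plane) : ψ x = (φ x : ℂ) := rfl
  have e := congrArg (fun T ↦ T ψ) (Lp.fourierInv_toTemperedDistribution_eq g)
  simp only [TemperedDistribution.fourierInv_apply, Lp.toTemperedDistribution_apply] at e
  have e2 : ∫ x, (𝓕⁻ (ψ : Plane → ℂ)) x • h x = ∫ x, ψ x • (𝓕⁻ h) x := by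
    have := VectorFourier.integral_fourierIntegral_smul_eq_flip (L := -innerₗ Plane)
      (μ := volume) (ν := volume) Real.continuous_fourierChar
      (by simpa using! continuous_inner.neg) ψ.integrable hh
    have flip : (-innerₗ Plane).flip = -innerₗ Plane := by
      ext x y; simp [real_inner_comm]
    rw [flip] at this
    exact this
  have key : ∫ x, φ x • (𝓕⁻ g : L2Plane) x = ∫ x, φ x • (𝓕⁻ h : Plane → ℂ) x := calc
    _ = ∫ x, ψ x • (𝓕⁻ g : L2Plane) x := by
        simp only [hψ, Complex.coe_smul]
    _ = ∫ x, (𝓕⁻ ψ) x • g x := e.symm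
    _ = ∫ x, (𝓕⁻ (ψ : Plane → ℂ)) x • h x := by
        apply integral_congr_ae
        filter_upwards [hg] with x hx
        rw [hx, SchwartzMap.fourierInv_coe]
    _ = ∫ x, ψ x • (𝓕⁻ h) x := e2
    _ = _ := by simp only [hψ, Complex.coe_smul]
  exact key

/-- For every `t` the function `freeEvolution η k u₀ · t` represents `e^{itΔ} P_k u₀ ∈ L²(ℝ²)`. -/
theorem freeEvolution_ae_eq (η : LPBump) (k : ℤ) (u₀ : L2Plane) (t : ℝ) :
    (schrodingerPropagator t (lpProjector η k u₀) : Plane → ℂ) =ᵐ[volume]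
      fun x ↦ freeEvolution η k u₀ x t := by
  refine fourierInv_ae_eq _ _ ?_ (integrable_evolutionSymbol η k u₀ t)
  rw [lpProjector, fourierMultiplier, FourierTransform.fourier_fourierInv_eq]
  filter_upwards [Lp.coeFn_lpSMul (r := 2) ((memLp_schrodingerSymbol t).toLp _)
      (((memLp_lpSymbol η k).toLp _ • (𝓕 u₀ : L2Plane) : L2Plane)),
    Lp.coeFn_lpSMul (r := 2) ((memLp_lpSymbol η k).toLp _) (𝓕 u₀ : L2Plane),
    (memLp_schrodingerSymbol t).coeFn_toLp, (memLp_lpSymbol η k).coeFn_toLp] with ξ h1 h2 h3 h4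
  rw [h1, Pi.smul_apply', h2, Pi.smul_apply', h3, h4, smul_eq_mul, smul_eq_mul, mul_assoc]

/-- Bumps exist. -/
instance : Nonempty LPBump := by
  refine ⟨⟨fun x ↦ Real.smoothTransition ((64 / 25 - x ^ 2) / (64 / 25 - 25 / 16)),
    ?_, ?_, ?_, ?_, ?_, ?_, ?_⟩⟩
  · exact Real.smoothTransition.contDiff.comp (by fun_prop)
  · intro x; simp
  · intro x; exact Real.smoothTransition.nonneg _
  · intro x; exact Real.smoothTransition.le_one _
  · intro x hx y hy hxy
    apply Real.smoothTransition.monotone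
    have hx' : (0 : ℝ) ≤ x := hx
    gcongr
  · intro x hx
    apply Real.smoothTransition.zero_of_nonpos
    apply div_nonpos_of_nonpos_of_nonneg _ (by norm_num)
    nlinarith [sq_abs x]
  · intro x hx
    apply Real.smoothTransition.one_of_one_le
    rw [le_div_iff₀ (by norm_num)]
    nlinarith [sq_abs x, abs_nonneg x]

end

open MeasureTheory Real Set FourierTransform
open scoped ENNReal ContDiff

noncomputable section

/-! ### Plane waves -/

/-! Both halves rest on the `TT*` principle. The adjoint of sampling the evolution at space-time
points is a superposition of conjugate plane waves (`superpose`, `sampleVec`), and inner products of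
such superpositions are integrals of a kernel evaluated at differences of the points.

Positive half. The angular energy at `(x, t)` depends on `x` only through `|x|`. On a line `x₁ =
const`, its supremum over `x₂` and `t` is therefore at most the sum of its suprema over the dyadic
annuli `2^j ≤ 2^k |x| < 2^(j+1)` that meet the line, plus a bounded core term. Integration in `x₁`
weights the `j`-th annulus by about `2^j / 2^k`, so it suffices to bound `∑ 2^j E_j` by `2^(2k)
‖u₀‖²`, where `E_j` is the energy on one arbitrary circle at one arbitrary time in each annulus
(`exists_sum_circleEnergy_le`). This is almost orthogonality. On a single circle only one time
occurs, the equal-time kernel has width `2^(-k)`, and a Schur test gains `2^(-j)`. Between annuli at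
least two apart, the bound `|K(x, t)| ≲ 2^k / |x|`, uniform in `t`, gives weighted inner products of
size `2^(-|i-j|/2)`, which are summable. The uniform bound combines non-stationary phase for small
times with the dispersive estimate for large ones (`exists_norm_mul_waveIntegral_le`).

Negative half. By duality it is enough to find a space-time curve over `x₁ ∈ (0, L/2^k]` whose
superposed waves have large energy near a frequency of size `2^k`. A curve moving with the group
velocity becomes, in the moving frame, a graph `s ↦ y(s)` with time proportional to `s`. After
Gaussian regularization the energy is a double integral of `gaussKernel`. If `y` is Hölder of
exponent `1/2`, that kernel is nonnegative, and it is bounded below by a multiple of `|y(s') -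
y(s)|² / |s' - s|²`. A lacunary sum oscillating by about `√σ` at `J` dyadic-type scales `σ` then
makes the energy at least a multiple of `J L`: a logarithmic divergence (`integral_lacunary_lower`,
`exists_curveWave_large`). -/

/-- The phase `2π x·ξ - t|2πξ|²` of a Schrödinger plane wave. -/
def wavePhase (p : Plane × ℝ) (ξ : Plane) : ℝ :=
  2 * π * inner ℝ p.1 ξ - p.2 * (2 * π * ‖ξ‖) ^ 2

/-- The Schrödinger plane wave of frequency `ξ` at the space-time point `p`. -/
def wave (p : Plane × ℝ) (ξ : Plane) : ℂ := Complex.exp (wavePhase p ξ * Complex.I)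

@[fun_prop]
theorem Continuous.wave {X : Type*} [TopologicalSpace X] {f : X → Plane × ℝ} {g : X → Plane}
    (hf : Continuous f) (hg : Continuous g) : Continuous fun x ↦ wave (f x) (g x) := by
  unfold _root_.wave wavePhase
  fun_prop

@[fun_prop]
theorem Measurable.wave {X : Type*} [MeasurableSpace X] {f : X → Plane × ℝ} {g : X → Plane}
    (hf : Measurable f) (hg : Measurable g) : Measurable fun x ↦ wave (f x) (g x) := by
  have : Measurable fun x ↦ (Inner.inner ℝ (f x).1 (g x) : ℝ) := hf.fst.inner hg
  unfold _root_.wave wavePhase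
  fun_prop

@[fun_prop]
theorem Continuous.conj {X : Type*} [TopologicalSpace X] {f : X → ℂ} (hf : Continuous f) :
    Continuous fun x ↦ (starRingEnd ℂ) (f x) := Complex.continuous_conj.comp hf

@[fun_prop]
theorem Measurable.conj {X : Type*} [MeasurableSpace X] {f : X → ℂ} (hf : Measurable f) :
    Measurable fun x ↦ (starRingEnd ℂ) (f x) := Complex.continuous_conj.measurable.comp hf

theorem norm_wave (p : Plane × ℝ) (ξ : Plane) : ‖wave p ξ‖ = 1 :=
  Complex.norm_exp_ofReal_mul_I _

theorem wavePhase_sub (p q : Plane × ℝ) (ξ : Plane) :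
    wavePhase (p - q) ξ = wavePhase p ξ - wavePhase q ξ := by
  simp only [wavePhase, Prod.fst_sub, Prod.snd_sub, inner_sub_left]
  ring

theorem conj_wave (p : Plane × ℝ) (ξ : Plane) :
    (starRingEnd ℂ) (wave p ξ) = Complex.exp (-(wavePhase p ξ * Complex.I)) := by
  rw [wave, ← Complex.exp_conj]
  simp

theorem wave_mul_conj_wave (p q : Plane × ℝ) (ξ : Plane) :
    wave p ξ * (starRingEnd ℂ) (wave q ξ) = wave (p - q) ξ := by
  rw [conj_wave, wave, wave, ← Complex.exp_add, wavePhase_sub]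
  congr 1
  push_cast
  ring

theorem wave_smul (c : ℝ) (p : Plane × ℝ) (ξ : Plane) :
    wave p (c • ξ) = wave (c • p.1, c ^ 2 * p.2) ξ := by
  simp only [wave, wavePhase, inner_smul_right, inner_smul_left, norm_smul, norm_eq_abs]
  congr 3
  simp only [mul_pow, sq_abs, conj_trivial]
  ring

attribute [irreducible] wave

/-- Superposition of plane waves with amplitude `f`. -/
def waveIntegral (f : Plane → ℂ) (p : Plane × ℝ) : ℂ := ∫ ξ, wave p ξ * f ξ

theorem freeEvolution_eq_waveIntegral (η : LPBump) (k : ℤ) (u₀ : L2Plane) (x : Plane) (t : ℝ) :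
    freeEvolution η k u₀ x t
      = waveIntegral (fun ξ ↦ lpSymbol η k ξ * (𝓕 u₀ : L2Plane) ξ) (x, t) := by
  rw [freeEvolution, Real.fourierInv_eq', waveIntegral]
  congr 1
  ext ξ
  rw [smul_eq_mul, schrodingerSymbol, ← mul_assoc, ← mul_assoc, ← mul_assoc, ← Complex.exp_add,
    wave, wavePhase, real_inner_comm]
  congr 3
  push_cast
  ring

theorem norm_waveIntegral_le (f : Plane → ℂ) (p : Plane × ℝ) :
    ‖waveIntegral f p‖ ≤ ∫ ξ, ‖f ξ‖ := by
  refine (norm_integral_le_integral_norm _).trans_eq ?_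
  simp [norm_wave]

theorem continuous_waveIntegral {f : Plane → ℂ} (hf : Integrable f) :
    Continuous (waveIntegral f) := by
  refine continuous_of_dominated (bound := fun ξ ↦ ‖f ξ‖) ?_ ?_ hf.norm ?_
  · exact fun p ↦ (by fun_prop : Measurable (wave p)).aestronglyMeasurable.mul hf.1
  · exact fun p ↦ .of_forall fun ξ ↦ by simp [norm_wave]
  · exact .of_forall fun ξ ↦ by fun_prop

theorem integrable_wave_mul {f : Plane → ℂ} (hf : Integrable f) (p : Plane × ℝ) :
    Integrable fun ξ ↦ wave p ξ * f ξ :=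
  hf.bdd_mul (by fun_prop : Measurable (wave p)).aestronglyMeasurable
    (c := 1) (.of_forall fun ξ ↦ (norm_wave p ξ).le)

theorem waveIntegral_comp_smul (f : Plane → ℂ) (c : ℝ) (p : Plane × ℝ) :
    waveIntegral f p = (c ^ 2) • waveIntegral (fun ξ ↦ f (c • ξ)) (c • p.1, c ^ 2 * p.2) ∨ c = 0 := by
  rcases eq_or_ne c 0 with hc | hc
  · exact .inr hc
  left
  have h := Measure.integral_comp_smul (volume : Measure Plane) (fun ξ ↦ wave p ξ * f ξ) c
  simp only [wave_smul, finrank_euclideanSpace_fin] at h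
  rw [waveIntegral, waveIntegral, h, smul_smul, abs_of_nonneg (by positivity),
    mul_inv_cancel₀ (by positivity), one_smul]

/-- The adjoint of sampling a wave integral along the points `p s`. -/
def superpose (μ : Measure ℝ) (p : ℝ → Plane × ℝ) (g : ℝ → ℂ) (ξ : Plane) : ℂ :=
  ∫ s, g s * (starRingEnd ℂ) (wave (p s) ξ) ∂μ

section superpose

variable {μ : Measure ℝ} {p : ℝ → Plane × ℝ} {g : ℝ → ℂ}

theorem norm_superpose_le (ξ : Plane) : ‖superpose μ p g ξ‖ ≤ ∫ s, ‖g s‖ ∂μ := by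
  refine (norm_integral_le_integral_norm _).trans_eq ?_
  simp [norm_wave]

theorem continuous_superpose (hp : Measurable p) (hg : Integrable g μ) :
    Continuous (superpose μ p g) := by
  refine continuous_of_dominated (bound := fun s ↦ ‖g s‖) ?_ ?_ hg.norm ?_
  · intro ξ
    have : Measurable fun s ↦ (starRingEnd ℂ) (wave (p s) ξ) := by fun_prop
    exact hg.1.mul this.aestronglyMeasurable
  · exact fun p ↦ .of_forall fun ξ ↦ by simp [norm_wave]
  · exact .of_forall fun s ↦ by fun_prop

variable [SFinite μ]

theorem integral_conj_mul_waveIntegral (hp : Measurable p) (hg : Integrable g μ)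
    {f : Plane → ℂ} (hf : Integrable f) :
    ∫ s, (starRingEnd ℂ) (g s) * waveIntegral f (p s) ∂μ
      = ∫ ξ, (starRingEnd ℂ) (superpose μ p g ξ) * f ξ := by
  have hint : Integrable (Function.uncurry fun s ξ ↦
      (starRingEnd ℂ) (g s) * (wave (p s) ξ * f ξ)) (μ.prod volume) := by
    have h1 : Integrable (fun z : ℝ × Plane ↦ (starRingEnd ℂ) (g z.1) * f z.2)
        (μ.prod volume) := by
      have hg' : Integrable (fun s ↦ (starRingEnd ℂ) (g s)) μ :=
        (Complex.conjCLE.toContinuousLinearMap.integrable_comp hg :)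
      exact hg'.mul_prod hf
    have hm : Measurable fun z : ℝ × Plane ↦ wave (p z.1) z.2 := by fun_prop
    refine (h1.bdd_mul (c := 1) hm.aestronglyMeasurable
      (.of_forall fun z ↦ (norm_wave _ _).le)).congr (.of_forall fun z ↦ ?_)
    simp only [Function.uncurry]
    ring
  simp only [waveIntegral, superpose, ← integral_const_mul, ← integral_conj, ← integral_mul_const]
  rw [integral_integral_swap hint]
  refine integral_congr_ae (.of_forall fun ξ ↦ integral_congr_ae (.of_forall fun s ↦ ?_))
  simp only [map_mul, Complex.conj_conj]
  ring

/-- This is the `TT*` identity: by Fubini and the character property of the waves, sampling a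
superposition only sees the kernel `waveIntegral f` at differences of points. -/
theorem waveIntegral_mul_superpose (hp : Measurable p) (hg : Integrable g μ)
    {f : Plane → ℂ} (hf : Integrable f) (q : Plane × ℝ) :
    waveIntegral (fun ξ ↦ f ξ * superpose μ p g ξ) q = ∫ s, g s * waveIntegral f (q - p s) ∂μ := by
  have hint : Integrable (Function.uncurry fun (ξ : Plane) s ↦
      (wave q ξ * f ξ) * (g s * (starRingEnd ℂ) (wave (p s) ξ))) (volume.prod μ) := by
    have h1 := (integrable_wave_mul hf q).mul_prod hg
    have hm : Measurable fun z : Plane × ℝ ↦ (starRingEnd ℂ) (wave (p z.2) z.1) := by fun_prop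
    refine (h1.bdd_mul (c := 1) hm.aestronglyMeasurable
      (.of_forall fun z ↦ by simp [norm_wave])).congr (.of_forall fun z ↦ ?_)
    simp only [Function.uncurry]
    ring
  simp only [waveIntegral, superpose, ← integral_const_mul, ← mul_assoc (wave q _)]
  rw [integral_integral_swap hint]
  refine integral_congr_ae (.of_forall fun s ↦ integral_congr_ae (.of_forall fun ξ ↦ ?_))
  simp only [← wave_mul_conj_wave]
  ring

end superpose

/-! ### Kernel estimates -/

theorem hasLineDerivAt_wave (x : Plane) (t : ℝ) (ξ : Plane) :
    HasLineDerivAt ℝ (wave (x, t)) (wave (x, t) ξ *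
      ((2 * π * (‖x‖ ^ 2 - 4 * π * t * inner ℝ x ξ) : ℝ) * Complex.I)) ξ x := by
  have h1 : HasDerivAt (fun s : ℝ ↦ wavePhase (x, t) (ξ + s • x))
      (2 * π * (‖x‖ ^ 2 - 4 * π * t * inner ℝ x ξ)) 0 := by
    have e : (fun s : ℝ ↦ wavePhase (x, t) (ξ + s • x)) = fun s ↦
        2 * π * (inner ℝ x ξ + s * ‖x‖ ^ 2)
          - t * (2 * π) ^ 2 * (‖ξ‖ ^ 2 + 2 * (s * inner ℝ x ξ) + s ^ 2 * ‖x‖ ^ 2) := by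
      ext s
      simp only [wavePhase, inner_add_right, inner_smul_right, real_inner_self_eq_norm_sq, mul_pow,
        norm_add_sq_real, norm_smul, norm_eq_abs, sq_abs, real_inner_comm ξ x]
      ring
    rw [e]
    have a1 : HasDerivAt (fun s : ℝ ↦ s) 1 0 := hasDerivAt_id 0
    have := (((a1.mul_const (‖x‖ ^ 2)).const_add (inner ℝ x ξ)).const_mul (2 * π)).sub
      (((((a1.mul_const (inner ℝ x ξ)).const_mul 2).const_add (‖ξ‖ ^ 2)).add
        ((a1.pow 2).mul_const (‖x‖ ^ 2))).const_mul (t * (2 * π) ^ 2))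
    refine HasDerivAt.congr_deriv this ?_
    simp
    ring
  have h2 := (h1.ofReal_comp.mul_const Complex.I).cexp
  simpa [HasLineDerivAt, wave] using h2

/-- Non-stationary phase: one integration by parts in the direction `x`. -/
theorem norm_waveIntegral_le_of_small_time {a : Plane → ℂ} (ha : ContDiff ℝ ∞ a)
    (hc : HasCompactSupport a) {R : ℝ} (hR : ∀ ξ ∈ tsupport a, ‖ξ‖ ≤ R) {x : Plane} {t : ℝ}
    (hxt : 8 * π * |t| * R ≤ ‖x‖) :
    2 * π * ‖x‖ ^ 2 * ‖waveIntegral a (x, t)‖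
      ≤ 2 * ‖x‖ * (∫ ξ, ‖fderiv ℝ a ξ‖) + 16 * π * |t| * ∫ ξ, ‖a ξ‖ := by
  rcases eq_or_ne x 0 with rfl | hx
  · simp only [norm_zero]
    have : 0 ≤ ∫ ξ, ‖a ξ‖ := integral_nonneg fun _ ↦ norm_nonneg _
    have := mul_nonneg (by positivity : 0 ≤ 16 * π * |t|) this
    simpa using this
  have hx0 : 0 < ‖x‖ := norm_pos_iff.2 hx
  -- The derivative of the phase along `x` is `2π‖x‖² D`. The hypothesis on `t` keeps `D ≥ 1/2` on
  -- the support of the amplitude, so there is no stationary point there.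
  set D : Plane → ℝ := fun ξ ↦ 1 - 4 * π * t * inner ℝ x ξ / ‖x‖ ^ 2 with hD
  have hDcont : Continuous D := by simp only [hD]; fun_prop
  have hDlow : ∀ ξ ∈ tsupport a, 1 / 2 ≤ D ξ := by
    intro ξ hξ
    have h1 : |4 * π * t * inner ℝ x ξ / ‖x‖ ^ 2| ≤ 1 / 2 := by
      rw [abs_div, abs_of_pos (by positivity : 0 < ‖x‖ ^ 2), div_le_iff₀ (by positivity),
        abs_mul, abs_mul, abs_of_pos (by positivity : 0 < 4 * π)]
      calc 4 * π * |t| * |inner ℝ x ξ| ≤ 4 * π * |t| * (‖x‖ * R) := by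
            gcongr
            exact (abs_real_inner_le_norm x ξ).trans (by gcongr; exact hR ξ hξ)
        _ = (8 * π * |t| * R) * ‖x‖ / 2 := by ring
        _ ≤ ‖x‖ * ‖x‖ / 2 := by gcongr
        _ = _ := by ring
    have := (abs_le.1 h1).2
    simp only [hD]
    linarith
  set A' : Plane → ℂ := fun ξ ↦ fderiv ℝ a ξ x
  have hA'c : Continuous A' := (ha.continuous_fderiv (by simp)).clm_apply continuous_const
  have hA's : ∀ ξ, ξ ∉ tsupport a → A' ξ = 0 := by
    intro ξ hξ
    have : fderiv ℝ a ξ = 0 := by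
      by_contra h
      exact hξ (support_fderiv_subset ℝ h)
    simp [A', this]
  have hfd : Integrable (fun ξ ↦ fderiv ℝ a ξ) :=
    (ha.continuous_fderiv (by simp)).integrable_of_hasCompactSupport (hc.fderiv ℝ)
  have haint : Integrable a := ha.continuous.integrable_of_hasCompactSupport hc
  have hA'int : Integrable A' :=
    (hfd.apply_continuousLinearMap x)
  -- Dividing the wave by `D` makes the main term of its derivative along `x` a constant multiple of
  -- the wave. The second term of `F'` comes from differentiating `D⁻¹`.
  set F : Plane → ℂ := fun ξ ↦ wave (x, t) ξ * ((D ξ : ℂ))⁻¹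
  set F' : Plane → ℂ := fun ξ ↦ wave (x, t) ξ * ((2 * π * ‖x‖ ^ 2 : ℝ) * Complex.I)
    + wave (x, t) ξ * ((4 * π * t : ℝ) * ((D ξ : ℂ))⁻¹ ^ 2)
  have hDm : Measurable fun ξ ↦ ((D ξ : ℂ))⁻¹ := (Complex.continuous_ofReal.comp hDcont).measurable.inv
  have hwm := (by fun_prop : Measurable (wave (x, t)))
  have hinv : ∀ ξ ∈ tsupport a, ‖((D ξ : ℂ))⁻¹‖ ≤ 2 := by
    intro ξ hξ
    have := hDlow ξ hξ
    rw [norm_inv, Complex.norm_real, norm_eq_abs, abs_of_pos (by linarith)]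
    calc (D ξ)⁻¹ ≤ (1 / 2 : ℝ)⁻¹ := by gcongr
      _ = 2 := by norm_num
  have hFA' : ∀ ξ, ‖F ξ * A' ξ‖ ≤ 2 * ‖A' ξ‖ := by
    intro ξ
    by_cases hξ : ξ ∈ tsupport a
    · rw [norm_mul, norm_mul, norm_wave, one_mul]
      gcongr
      exact hinv ξ hξ
    · simp [hA's ξ hξ]
  have hFa : ∀ ξ, ‖F ξ * a ξ‖ ≤ 2 * ‖a ξ‖ := by
    intro ξ
    by_cases hξ : ξ ∈ tsupport a
    · rw [norm_mul, norm_mul, norm_wave, one_mul]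
      gcongr
      exact hinv ξ hξ
    · simp [image_eq_zero_of_notMem_tsupport hξ]
  have hE : ∀ ξ, ‖wave (x, t) ξ * ((4 * π * t : ℝ) * ((D ξ : ℂ))⁻¹ ^ 2) * a ξ‖
      ≤ 16 * π * |t| * ‖a ξ‖ := by
    intro ξ
    by_cases hξ : ξ ∈ tsupport a
    · rw [norm_mul, norm_mul, norm_wave, one_mul, norm_mul, norm_pow, Complex.norm_real,
        norm_eq_abs, abs_mul, abs_of_pos (by positivity : 0 < 4 * π)]
      calc 4 * π * |t| * ‖((D ξ : ℂ))⁻¹‖ ^ 2 * ‖a ξ‖ ≤ 4 * π * |t| * 2 ^ 2 * ‖a ξ‖ := by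
            gcongr
            exact hinv ξ hξ
        _ = _ := by ring
    · simp [image_eq_zero_of_notMem_tsupport hξ]
  have iFA' : Integrable fun ξ ↦ F ξ * A' ξ :=
    (hA'int.norm.const_mul 2).mono' ((hwm.mul hDm).mul hA'c.measurable).aestronglyMeasurable
      (.of_forall hFA')
  have iFa : Integrable fun ξ ↦ F ξ * a ξ :=
    (haint.norm.const_mul 2).mono' ((hwm.mul hDm).mul ha.continuous.measurable).aestronglyMeasurable
      (.of_forall hFa)
  have iE : Integrable fun ξ ↦ wave (x, t) ξ * ((4 * π * t : ℝ) * ((D ξ : ℂ))⁻¹ ^ 2) * a ξ :=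
    (haint.norm.const_mul (16 * π * |t|)).mono'
      ((hwm.mul ((hDm.pow_const 2).const_mul _)).mul ha.continuous.measurable).aestronglyMeasurable
      (.of_forall hE)
  have iW : Integrable fun ξ ↦ wave (x, t) ξ * ((2 * π * ‖x‖ ^ 2 : ℝ) * Complex.I) * a ξ :=
    ((integrable_wave_mul haint (x, t)).const_mul ((2 * π * ‖x‖ ^ 2 : ℝ) * Complex.I)).congr
      (.of_forall fun ξ ↦ by ring)
  have key := integral_bilinear_hasLineDerivAt_right_eq_neg_left_of_integrable
    (μ := (volume : Measure Plane)) (f := F) (f' := F') (g := a) (g' := A') (v := x)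
    (B := ContinuousLinearMap.mul ℝ ℂ)
    (by
      simp only [ContinuousLinearMap.mul_apply', F', add_mul]
      exact iW.add iE)
    iFA' iFa
    (by
      intro ξ hξ
      have hD0 : (D ξ : ℂ) ≠ 0 := by
        have := hDlow ξ hξ
        exact_mod_cast (by linarith : D ξ ≠ 0)
      have hDd : HasDerivAt (fun s : ℝ ↦ D (ξ + s • x)) (-(4 * π * t)) 0 := by
        have e : (fun s : ℝ ↦ D (ξ + s • x)) = fun s ↦
            1 - 4 * π * t * inner ℝ x ξ / ‖x‖ ^ 2 - s * (4 * π * t) := by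
          ext s
          simp only [hD, inner_add_right, inner_smul_right, real_inner_self_eq_norm_sq]
          field_simp
          ring
        rw [e]
        simpa using ((hasDerivAt_id (0 : ℝ)).mul_const (4 * π * t)).const_sub
          (1 - 4 * π * t * inner ℝ x ξ / ‖x‖ ^ 2)
      have hDi := hDd.ofReal_comp.inv (by simpa using hD0)
      have hw := hasLineDerivAt_wave x t ξ
      have := HasDerivAt.mul (show HasDerivAt (fun s : ℝ ↦ wave (x, t) (ξ + s • x)) _ 0 from hw) hDi
      show HasDerivAt (fun s : ℝ ↦ F (ξ + s • x)) (F' ξ) 0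
      refine HasDerivAt.congr_deriv this ?_
      have hDx : (2 * π * (‖x‖ ^ 2 - 4 * π * t * inner ℝ x ξ) : ℝ) = 2 * π * ‖x‖ ^ 2 * D ξ := by
        simp only [hD]
        field_simp
      rw [hDx]
      simp only [F', zero_smul, add_zero, Pi.inv_apply]
      push_cast
      field_simp)
    (by
      intro ξ _
      exact ((ha.differentiable (by simp)) ξ).hasFDerivAt.hasLineDerivAt x)
  simp only [ContinuousLinearMap.mul_apply', F', add_mul] at key
  rw [integral_add iW iE] at key
  have eW : ∫ ξ, wave (x, t) ξ * ((2 * π * ‖x‖ ^ 2 : ℝ) * Complex.I) * a ξ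
      = ((2 * π * ‖x‖ ^ 2 : ℝ) * Complex.I) * waveIntegral a (x, t) := by
    rw [waveIntegral, ← integral_const_mul]
    exact integral_congr_ae (.of_forall fun ξ ↦ by ring)
  rw [eW] at key
  have n1 : ‖((2 * π * ‖x‖ ^ 2 : ℝ) * Complex.I) * waveIntegral a (x, t)‖
      = 2 * π * ‖x‖ ^ 2 * ‖waveIntegral a (x, t)‖ := by
    rw [norm_mul, norm_mul, Complex.norm_I, Complex.norm_real, norm_eq_abs,
      abs_of_nonneg (by positivity), mul_one]
  rw [← n1]
  have e3 : ((2 * π * ‖x‖ ^ 2 : ℝ) * Complex.I) * waveIntegral a (x, t)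
      = -(∫ ξ, F ξ * A' ξ)
        - ∫ ξ, wave (x, t) ξ * ((4 * π * t : ℝ) * ((D ξ : ℂ))⁻¹ ^ 2) * a ξ := by
    rw [key]; ring
  rw [e3]
  refine (norm_sub_le _ _).trans (add_le_add ?_ ?_)
  · rw [norm_neg]
    refine (norm_integral_le_integral_norm _).trans ?_
    rw [← integral_const_mul]
    refine integral_mono iFA'.norm (hfd.norm.const_mul _) fun ξ ↦ ?_
    refine (hFA' ξ).trans ?_
    have := (fderiv ℝ a ξ).le_opNorm x
    simp only [A']
    nlinarith
  · refine (norm_integral_le_integral_norm _).trans ?_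
    rw [← integral_const_mul]
    exact integral_mono iE.norm (haint.norm.const_mul _) hE

/-- The Gaussian is `π / b` times the Fourier transform of `exp (-c‖v‖²)` with `c = π² / b`. Moving
the transform onto `f` leaves a factor of modulus at most one, because `0 < c.re`. -/
theorem norm_integral_gaussian_mul_le {f : Plane → ℂ} (hf : Integrable f) {b : ℂ} (hb : 0 < b.re)
    (hF : Integrable (𝓕 f)) :
    ‖∫ ξ, Complex.exp (-b * ‖ξ‖ ^ 2) * f ξ‖ ≤ π / ‖b‖ * ∫ y, ‖𝓕 f y‖ := by
  have hb0 : b ≠ 0 := fun h ↦ by simp [h] at hb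
  set c : ℂ := π ^ 2 / b with hc
  have hcre : 0 < c.re := by
    have : c = (π ^ 2 : ℝ) * b⁻¹ := by rw [hc]; push_cast; ring
    rw [this, Complex.re_ofReal_mul, Complex.inv_re]
    have := Complex.normSq_pos.2 hb0
    positivity
  have hpi : (π : ℂ) ≠ 0 := by exact_mod_cast Real.pi_ne_zero
  have hgauss : ∀ ξ : Plane, Complex.exp (-b * ‖ξ‖ ^ 2)
      = (π / b) * 𝓕 (fun v : Plane ↦ Complex.exp (-c * ‖v‖ ^ 2)) ξ := by
    intro ξ
    rw [fourier_gaussian_innerProductSpace hcre]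
    have e1 : (π / c : ℂ) = b / π := by rw [hc]; field_simp
    have e2 : -(π : ℂ) ^ 2 * ‖ξ‖ ^ 2 / c = -b * ‖ξ‖ ^ 2 := by rw [hc]; field_simp
    rw [finrank_euclideanSpace_fin, e1, e2]
    norm_num
    field_simp
  have hg : Integrable fun v : Plane ↦ Complex.exp (-c * ‖v‖ ^ 2) := by
    simpa using GaussianFourier.integrable_cexp_neg_mul_sq_norm_add hcre 0 (0 : Plane)
  have swap : ∫ ξ, 𝓕 (fun v : Plane ↦ Complex.exp (-c * ‖v‖ ^ 2)) ξ * f ξ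
      = ∫ v, Complex.exp (-c * ‖v‖ ^ 2) * 𝓕 f v := by
    have := VectorFourier.integral_fourierIntegral_smul_eq_flip (L := innerₗ Plane)
      (μ := volume) (ν := volume) Real.continuous_fourierChar
      (by simpa using! continuous_inner) hg hf
    rw [flip_innerₗ] at this
    exact this
  simp only [hgauss, mul_assoc]
  rw [integral_const_mul, swap, norm_mul, norm_div, Complex.norm_real, norm_eq_abs,
    abs_of_pos Real.pi_pos]
  gcongr
  refine (norm_integral_le_integral_norm _).trans ?_
  refine integral_mono_of_nonneg (.of_forall fun _ ↦ norm_nonneg _) hF.norm (.of_forall fun v ↦ ?_)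
  simp only [norm_mul]
  refine mul_le_of_le_one_left (norm_nonneg _) ?_
  rw [Complex.norm_exp, Real.exp_le_one_iff]
  have : (-c * (‖v‖ : ℂ) ^ 2).re = -(c.re * ‖v‖ ^ 2) := by
    rw [← Complex.ofReal_pow, Complex.re_mul_ofReal, Complex.neg_re]; ring
  rw [this]
  have := mul_nonneg hcre.le (sq_nonneg ‖v‖)
  linarith

/-- The dispersive estimate for frequency-localized data. -/
theorem abs_time_mul_norm_waveIntegral_le {a : Plane → ℂ} (ha : Integrable a)
    (hF : Integrable (𝓕 a)) (x : Plane) (t : ℝ) :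
    4 * π * |t| * ‖waveIntegral a (x, t)‖ ≤ ∫ y, ‖𝓕 a y‖ := by
  rcases eq_or_ne t 0 with rfl | ht
  · simpa using integral_nonneg fun _ ↦ norm_nonneg _
  set f : Plane → ℂ := fun ξ ↦ Complex.exp ((2 * π * inner ℝ x ξ : ℝ) * Complex.I) * a ξ with hf
  have hfi : Integrable f := by
    refine ha.bdd_mul (c := 1) (Continuous.aestronglyMeasurable (by fun_prop))
      (.of_forall fun ξ ↦ (Complex.norm_exp_ofReal_mul_I _).le)
  have hFf : ∀ y, 𝓕 f y = 𝓕 a (y - x) := by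
    intro y
    rw [Real.fourier_eq', Real.fourier_eq']
    congr 1
    ext ξ
    simp only [hf, smul_eq_mul, ← mul_assoc, ← Complex.exp_add]
    congr 2
    rw [inner_sub_right, real_inner_comm x ξ]
    push_cast
    ring
  have hFfi : Integrable (𝓕 f) := by
    rw [show 𝓕 f = fun y ↦ 𝓕 a (y - x) from funext hFf]
    exact hF.comp_sub_right x
  have hint : ∫ y, ‖𝓕 f y‖ = ∫ y, ‖𝓕 a y‖ := by
    simp only [hFf]
    exact integral_sub_right_eq_self (fun y ↦ ‖𝓕 a y‖) x
  -- The purely imaginary Gaussian is regularized by a real part `ε > 0`. The bound survives `ε → 0`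
  -- since `‖b ε‖ ≥ 4π²|t|`.
  set b : ℝ → ℂ := fun ε ↦ ε + (4 * π ^ 2 * t : ℝ) * Complex.I with hb
  have hbre : ∀ ε, (b ε).re = ε := fun ε ↦ by
    simp only [hb, Complex.add_re, Complex.ofReal_re, Complex.mul_I_re, Complex.ofReal_im,
      neg_zero, add_zero]
  have hbim : ∀ ε, (b ε).im = 4 * π ^ 2 * t := fun ε ↦ by
    simp only [hb, Complex.add_im, Complex.ofReal_im, zero_add, Complex.mul_I_im,
      Complex.ofReal_re]
  have hlim : Filter.Tendsto (fun ε : ℝ ↦ ∫ ξ, Complex.exp (-b ε * ‖ξ‖ ^ 2) * f ξ)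
      (nhdsWithin 0 (Ioi 0)) (nhds (waveIntegral a (x, t))) := by
    have e : waveIntegral a (x, t) = ∫ ξ, Complex.exp (-b 0 * ‖ξ‖ ^ 2) * f ξ := by
      rw [waveIntegral]
      congr 1
      ext ξ
      simp only [hf, ← mul_assoc, ← Complex.exp_add, wave, wavePhase, hb]
      congr 2
      push_cast
      ring
    rw [e]
    refine tendsto_integral_filter_of_dominated_convergence (fun ξ ↦ ‖f ξ‖) ?_ ?_ hfi.norm ?_
    · exact .of_forall fun ε ↦ (Continuous.aestronglyMeasurable (by fun_prop)).mul hfi.1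
    · filter_upwards [self_mem_nhdsWithin] with ε hε
      refine .of_forall fun ξ ↦ ?_
      rw [norm_mul]
      refine mul_le_of_le_one_left (norm_nonneg _) ?_
      rw [Complex.norm_exp, Real.exp_le_one_iff, ← Complex.ofReal_pow, Complex.re_mul_ofReal,
        Complex.neg_re, hbre]
      have := mul_nonneg (le_of_lt hε) (sq_nonneg ‖ξ‖)
      linarith
    · refine .of_forall fun ξ ↦ ?_
      have : Continuous fun ε : ℝ ↦ Complex.exp (-b ε * ‖ξ‖ ^ 2) * f ξ := by
        simp only [hb]
        fun_prop
      exact (this.tendsto 0).mono_left nhdsWithin_le_nhds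
  have hbound : ∀ᶠ ε in nhdsWithin (0 : ℝ) (Ioi 0),
      ‖∫ ξ, Complex.exp (-b ε * ‖ξ‖ ^ 2) * f ξ‖ ≤ π / (4 * π ^ 2 * |t|) * ∫ y, ‖𝓕 a y‖ := by
    filter_upwards [self_mem_nhdsWithin] with ε hε
    have hε' : 0 < ε := hε
    refine (norm_integral_gaussian_mul_le hfi (by rw [hbre]; exact hε') hFfi).trans ?_
    rw [hint]
    have h1 : 4 * π ^ 2 * |t| ≤ ‖b ε‖ := by
      have := Complex.abs_im_le_norm (b ε)
      rwa [hbim, abs_mul, abs_of_pos (by positivity)] at this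
    have : 0 < |t| := abs_pos.2 ht
    gcongr
  have := le_of_tendsto hlim.norm hbound
  have ht' : 0 < |t| := abs_pos.2 ht
  calc 4 * π * |t| * ‖waveIntegral a (x, t)‖
      ≤ 4 * π * |t| * (π / (4 * π ^ 2 * |t|) * ∫ y, ‖𝓕 a y‖) := by gcongr
    _ = _ := by field_simp

/-- If `‖x‖` dominates `|t|`, the phase is non-stationary on the support and one integration by
parts gains `‖x‖⁻¹`. Otherwise `‖x‖ ≲ |t|`, and dispersive decay `|t|⁻¹` is at least as good. -/
theorem exists_norm_mul_waveIntegral_le {a : Plane → ℂ} (ha : ContDiff ℝ ∞ a)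
    (hc : HasCompactSupport a) :
    ∃ C, ∀ x t, ‖x‖ * ‖waveIntegral a (x, t)‖ ≤ C := by
  obtain ⟨R, hR0, hR⟩ : ∃ R, 0 < R ∧ ∀ ξ ∈ tsupport a, ‖ξ‖ ≤ R := by
    obtain ⟨R, hR⟩ := hc.isCompact.isBounded.exists_norm_le
    exact ⟨max R 1, by positivity, fun ξ hξ ↦ (hR ξ hξ).trans (le_max_left _ _)⟩
  have haint : Integrable a := ha.continuous.integrable_of_hasCompactSupport hc
  have hF : Integrable (𝓕 a) := by
    have := (𝓕 (hc.toSchwartzMap ha)).integrable (μ := (volume : Measure Plane))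
    rwa [SchwartzMap.fourier_coe] at this
  have i1 : 0 ≤ ∫ ξ, ‖fderiv ℝ a ξ‖ := integral_nonneg fun _ ↦ norm_nonneg _
  have i2 : 0 ≤ ∫ ξ, ‖a ξ‖ := integral_nonneg fun _ ↦ norm_nonneg _
  have i3 : 0 ≤ ∫ ξ, ‖𝓕 a ξ‖ := integral_nonneg fun _ ↦ norm_nonneg _
  refine ⟨(∫ ξ, ‖fderiv ℝ a ξ‖) + (∫ ξ, ‖a ξ‖) / R + 2 * R * ∫ y, ‖𝓕 a y‖, fun x t ↦ ?_⟩
  rcases le_or_gt (8 * π * |t| * R) ‖x‖ with h | h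
  · rcases eq_or_ne x 0 with rfl | hx
    · simp only [norm_zero, zero_mul]
      positivity
    have hx0 : 0 < ‖x‖ := norm_pos_iff.2 hx
    have := norm_waveIntegral_le_of_small_time ha hc hR h
    have h2 : 16 * π * |t| * (∫ ξ, ‖a ξ‖) ≤ 2 * ‖x‖ / R * ∫ ξ, ‖a ξ‖ := by
      gcongr
      rw [le_div_iff₀ hR0]
      linarith
    have h3 : ‖x‖ * ‖waveIntegral a (x, t)‖ * π ≤ (∫ ξ, ‖fderiv ℝ a ξ‖) + (∫ ξ, ‖a ξ‖) / R := by
      have e : 2 * π * ‖x‖ ^ 2 * ‖waveIntegral a (x, t)‖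
          = 2 * ‖x‖ * (‖x‖ * ‖waveIntegral a (x, t)‖ * π) := by ring
      have e' : 2 * ‖x‖ * (∫ ξ, ‖fderiv ℝ a ξ‖) + 2 * ‖x‖ / R * (∫ ξ, ‖a ξ‖)
        = 2 * ‖x‖ * ((∫ ξ, ‖fderiv ℝ a ξ‖) + (∫ ξ, ‖a ξ‖) / R) := by ring
      refine le_of_mul_le_mul_left ?_ (by positivity : 0 < 2 * ‖x‖)
      rw [← e, ← e']
      linarith
    have h4 : ‖x‖ * ‖waveIntegral a (x, t)‖ ≤ ‖x‖ * ‖waveIntegral a (x, t)‖ * π :=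
      le_mul_of_one_le_right (by positivity) (by linarith [Real.pi_gt_three])
    have : 0 ≤ 2 * R * ∫ y, ‖𝓕 a y‖ := by positivity
    linarith
  · have := abs_time_mul_norm_waveIntegral_le haint hF x t
    calc ‖x‖ * ‖waveIntegral a (x, t)‖ ≤ 8 * π * |t| * R * ‖waveIntegral a (x, t)‖ := by gcongr
      _ = 2 * R * (4 * π * |t| * ‖waveIntegral a (x, t)‖) := by ring
      _ ≤ 2 * R * ∫ y, ‖𝓕 a y‖ := by gcongr
      _ ≤ _ := by
        have : 0 ≤ (∫ ξ, ‖a ξ‖) / R := by positivity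
        linarith

/-- At time zero the integral is the inverse Fourier transform of a test function, hence Schwartz.
Quadratic decay is what the Schur test along a circle needs. -/
theorem exists_waveIntegral_zero_le {a : Plane → ℂ} (ha : ContDiff ℝ ∞ a)
    (hc : HasCompactSupport a) :
    ∃ C, ∀ x, (1 + ‖x‖ ^ 2) * ‖waveIntegral a (x, 0)‖ ≤ C := by
  set F := 𝓕⁻ (hc.toSchwartzMap ha)
  have hF : ∀ x, waveIntegral a (x, 0) = F x := by
    intro x
    have : F x = (𝓕⁻ a) x := by
      simp only [F]
      rw [SchwartzMap.fourierInv_coe]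
      rfl
    rw [this, Real.fourierInv_eq', waveIntegral]
    congr 1
    ext ξ
    simp [wave, wavePhase, real_inner_comm]
  obtain ⟨C0, -, h0⟩ := F.decay 0 0
  obtain ⟨C2, -, h2⟩ := F.decay 2 0
  refine ⟨C0 + C2, fun x ↦ ?_⟩
  have a0 := h0 x
  have a2 := h2 x
  simp only [pow_zero, one_mul, norm_iteratedFDeriv_zero] at a0 a2
  rw [hF]
  linarith

/-! ### The Littlewood-Paley symbol -/

theorem lpSymbol_smul (η : LPBump) (k : ℤ) (ξ : Plane) :
    lpSymbol η k ((2 : ℝ) ^ k • ξ) = lpSymbol η 0 ξ := by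
  have h2 : (0 : ℝ) < 2 ^ k := by positivity
  simp only [lpSymbol, LPBump.chi, norm_smul, norm_eq_abs, abs_of_pos h2]
  congr 3
  · field_simp
  · rw [zpow_sub_one₀ two_ne_zero, zpow_sub_one₀ two_ne_zero]
    field_simp

theorem contDiff_lpSymbol (η : LPBump) (k : ℤ) : ContDiff ℝ ∞ (lpSymbol η k) := by
  rw [contDiff_iff_contDiffAt]
  intro ξ
  rcases eq_or_ne ξ 0 with rfl | hξ
  -- The norm is not smooth at the origin, but both cutoffs equal one nearby and cancel.
  · have hev : ∀ᶠ ξ : Plane in nhds 0, lpSymbol η k ξ = 0 := by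
      have hcont : Continuous fun ξ : Plane ↦ 2 * π * ‖ξ‖ / 2 ^ (k - 1) := by fun_prop
      have h1 : ∀ᶠ ξ : Plane in nhds 0, 2 * π * ‖ξ‖ / 2 ^ (k - 1) < 5 / 4 :=
        hcont.continuousAt.eventually_lt continuousAt_const (by simp)
      filter_upwards [h1] with ξ hξ
      have e : 2 * π * ‖ξ‖ / 2 ^ k ≤ 2 * π * ‖ξ‖ / 2 ^ (k - 1) := by
        gcongr
        · norm_num
        · linarith
      have n1 : 0 ≤ 2 * π * ‖ξ‖ / 2 ^ k := by positivity
      have n2 : 0 ≤ 2 * π * ‖ξ‖ / 2 ^ (k - 1) := by positivity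
      rw [lpSymbol, LPBump.chi, η.eq_one _ (by rw [abs_of_nonneg n1]; linarith),
        η.eq_one _ (by rw [abs_of_nonneg n2]; linarith)]
      simp
    exact (contDiffAt_const (c := (0 : ℂ))).congr_of_eventuallyEq hev
  · have hn : ContDiffAt ℝ ∞ (fun ξ : Plane ↦ ‖ξ‖) ξ := contDiffAt_norm ℝ hξ
    have h : ∀ c : ℝ, ContDiffAt ℝ ∞ (fun ξ : Plane ↦ η.toFun (2 * π * ‖ξ‖ / c)) ξ := fun c ↦
      η.smooth.contDiffAt.comp ξ ((contDiffAt_const.mul hn).div_const c)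
    exact Complex.ofRealCLM.contDiff.contDiffAt.comp ξ ((h _).sub (h _))

/-- The kernel of `P_k P_k^* e^{itΔ}`. -/
def lpKernel (η : LPBump) (k : ℤ) : Plane × ℝ → ℂ := waveIntegral fun ξ ↦ lpSymbol η k ξ ^ 2

/-- Parabolic scaling reduces all kernel bounds to `k = 0` and so makes their constants independent
of `k`. -/
theorem lpKernel_eq (η : LPBump) (k : ℤ) (p : Plane × ℝ) :
    lpKernel η k p = ((2 : ℝ) ^ k) ^ 2 •
      lpKernel η 0 ((2 : ℝ) ^ k • p.1, ((2 : ℝ) ^ k) ^ 2 * p.2) := by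
  have h := (waveIntegral_comp_smul (fun ξ ↦ lpSymbol η k ξ ^ 2) (2 ^ k) p).resolve_right
    (by positivity)
  simp only [lpSymbol_smul] at h
  exact h

theorem exists_lpKernel_bounds (η : LPBump) : ∃ C, 0 < C ∧ ∀ (k : ℤ) (x : Plane) (t : ℝ),
    ‖x‖ * ‖lpKernel η k (x, t)‖ ≤ C * 2 ^ k ∧
    (1 + (2 ^ k * ‖x‖) ^ 2) * ‖lpKernel η k (x, 0)‖ ≤ C * (2 ^ k) ^ 2 := by
  have ha : ContDiff ℝ ∞ fun ξ ↦ lpSymbol η 0 ξ ^ 2 := (contDiff_lpSymbol η 0).pow 2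
  have hc : HasCompactSupport fun ξ ↦ lpSymbol η 0 ξ ^ 2 :=
    (hasCompactSupport_lpSymbol η 0).comp_left (g := fun z : ℂ ↦ z ^ 2) (by simp)
  obtain ⟨C₁, h₁⟩ := exists_norm_mul_waveIntegral_le ha hc
  obtain ⟨C₂, h₂⟩ := exists_waveIntegral_zero_le ha hc
  refine ⟨max (max C₁ C₂) 1, by positivity, fun k x t ↦ ?_⟩
  have hl : (0 : ℝ) < 2 ^ k := by positivity
  set l : ℝ := 2 ^ k
  constructor
  · rw [lpKernel_eq, norm_smul, norm_eq_abs, abs_of_pos (by positivity)]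
    have := h₁ (l • x) (l ^ 2 * t)
    rw [norm_smul, norm_eq_abs, abs_of_pos hl] at this
    calc ‖x‖ * (l ^ 2 * ‖lpKernel η 0 (l • x, l ^ 2 * t)‖)
        = (l * ‖x‖ * ‖lpKernel η 0 (l • x, l ^ 2 * t)‖) * l := by ring
      _ ≤ max (max C₁ C₂) 1 * l := by
        gcongr
        exact this.trans ((le_max_left _ _).trans (le_max_left _ _))
  · rw [lpKernel_eq, norm_smul, norm_eq_abs, abs_of_pos (by positivity)]
    have := h₂ (l • x)
    rw [norm_smul, norm_eq_abs, abs_of_pos hl] at this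
    simp only [mul_zero]
    calc (1 + (l * ‖x‖) ^ 2) * (l ^ 2 * ‖lpKernel η 0 (l • x, 0)‖)
        = ((1 + (l * ‖x‖) ^ 2) * ‖lpKernel η 0 (l • x, 0)‖) * l ^ 2 := by ring
      _ ≤ max (max C₁ C₂) 1 * l ^ 2 := by
        gcongr
        exact this.trans ((le_max_right _ _).trans (le_max_left _ _))

/-! ### Almost orthogonality -/

/-- With `V = ∑ v j` and `Q = ∑ q j ^ 2`, pairing with `h` gives `Q ≤ ‖V‖ ‖h‖`, while the Schur test
for the symmetric weights `W` gives `‖V‖² ≤ S Q`. Combining the two cancels one factor `Q`. -/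
theorem sum_sq_le_of_almost_orthogonal {H : Type*} [NormedAddCommGroup H] [InnerProductSpace ℂ H]
    {ι : Type*} (s : Finset ι) (h : H) (v : ι → H) (q : ι → ℝ) (W : ι → ι → ℝ) {S : ℝ} (hS0 : 0 ≤ S)
    (hvh : ∀ j ∈ s, inner ℂ (v j) h = ((q j ^ 2 : ℝ) : ℂ))
    (hW : ∀ i j, W i j = W j i) (hW0 : ∀ i j, 0 ≤ W i j) (hS : ∀ i ∈ s, ∑ j ∈ s, W i j ≤ S)
    (hv : ∀ i ∈ s, ∀ j ∈ s, ‖(inner ℂ (v i) (v j) : ℂ)‖ ≤ W i j * (q i * q j)) :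
    ∑ j ∈ s, q j ^ 2 ≤ S * ‖h‖ ^ 2 := by
  set V := ∑ j ∈ s, v j
  set Q := ∑ j ∈ s, q j ^ 2 with hQ
  have hQ0 : 0 ≤ Q := Finset.sum_nonneg fun _ _ ↦ sq_nonneg _
  have h1 : Q ≤ ‖V‖ * ‖h‖ := by
    have e : inner ℂ V h = (Q : ℂ) := by
      rw [sum_inner, Finset.sum_congr rfl hvh]
      simp [Q]
    have := norm_inner_le_norm (𝕜 := ℂ) V h
    rwa [e, Complex.norm_real, norm_eq_abs, abs_of_nonneg hQ0] at this
  have h2 : ‖V‖ ^ 2 ≤ S * Q := by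
    have e : ((‖V‖ ^ 2 : ℝ) : ℂ) = ∑ i ∈ s, ∑ j ∈ s, inner ℂ (v i) (v j) := by
      rw [Finset.sum_comm]
      have h := inner_self_eq_norm_sq_to_K (𝕜 := ℂ) V
      simp only [V, sum_inner, inner_sum] at h
      simpa using h.symm
    have n : ‖V‖ ^ 2 = ‖((‖V‖ ^ 2 : ℝ) : ℂ)‖ := by
      rw [Complex.norm_real, norm_eq_abs, abs_of_nonneg (by positivity)]
    have hsym : ∑ i ∈ s, ∑ j ∈ s, W i j * q j ^ 2 = ∑ i ∈ s, ∑ j ∈ s, W i j * q i ^ 2 := by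
      rw [Finset.sum_comm]
      simp only [hW]
    calc ‖V‖ ^ 2 ≤ ∑ i ∈ s, ∑ j ∈ s, W i j * (q i * q j) := by
          rw [n, e]
          refine (norm_sum_le _ _).trans (Finset.sum_le_sum fun i hi ↦ ?_)
          exact (norm_sum_le _ _).trans (Finset.sum_le_sum fun j hj ↦ hv i hi j hj)
      _ ≤ ∑ i ∈ s, ∑ j ∈ s, (W i j * q i ^ 2 + W i j * q j ^ 2) / 2 := by
          gcongr with i _ j _
          nlinarith [mul_nonneg (hW0 i j) (sq_nonneg (q i - q j))]
      _ = ∑ i ∈ s, (∑ j ∈ s, W i j) * q i ^ 2 := by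
          simp only [← Finset.sum_div, Finset.sum_add_distrib, Finset.sum_mul]
          rw [hsym]
          ring
      _ ≤ ∑ i ∈ s, S * q i ^ 2 := by
          gcongr with i hi
          exact hS i hi
      _ = S * Q := by rw [hQ, Finset.mul_sum]
  rcases hQ0.eq_or_lt with h0 | h0
  · rw [← h0]
    positivity
  · have h3 : Q ^ 2 ≤ S * Q * ‖h‖ ^ 2 := by
      calc Q ^ 2 ≤ (‖V‖ * ‖h‖) ^ 2 := by gcongr
        _ = ‖V‖ ^ 2 * ‖h‖ ^ 2 := by ring
        _ ≤ _ := by gcongr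
    refine le_of_mul_le_mul_left ?_ h0
    linarith

theorem sum_pow_le_of_injOn {ι : Type*} (s : Finset ι) (f : ι → ℕ) (hf : Set.InjOn f s) {ρ : ℝ}
    (h0 : 0 ≤ ρ) (h1 : ρ < 1) : ∑ j ∈ s, ρ ^ f j ≤ (1 - ρ)⁻¹ := by
  classical
  rw [← Finset.sum_image (f := fun n ↦ ρ ^ n) hf, ← tsum_geometric_of_lt_one h0 h1]
  exact (summable_geometric_of_lt_one h0 h1).sum_le_tsum _ fun _ _ ↦ by positivity

/-- With truncated subtraction the exponent is `|i - j|`, and each side of `i` is dominated by one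
geometric series. -/
theorem sum_pow_dist_le (s : Finset ℕ) (i : ℕ) {ρ : ℝ} (h0 : 0 ≤ ρ) (h1 : ρ < 1) :
    ∑ j ∈ s, ρ ^ ((i - j) + (j - i)) ≤ 2 * (1 - ρ)⁻¹ := by
  rw [← Finset.sum_filter_add_sum_filter_not s (fun j ↦ j ≤ i), two_mul]
  refine add_le_add (sum_pow_le_of_injOn _ _ ?_ h0 h1) (sum_pow_le_of_injOn _ _ ?_ h0 h1)
  · intro a ha b hb hab
    simp only [Finset.coe_filter, mem_ofPred_eq] at ha hb hab
    lia
  · intro a ha b hb hab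
    simp only [Finset.coe_filter, mem_ofPred_eq] at ha hb hab
    lia

/-! ### The adjoint of the evolution -/

section sampleVec

variable (η : LPBump) (k : ℤ)

theorem conj_lpSymbol (ξ : Plane) : (starRingEnd ℂ) (lpSymbol η k ξ) = lpSymbol η k ξ :=
  Complex.conj_ofReal _

theorem memLp_lpSymbol_two : MemLp (lpSymbol η k) 2 :=
  (continuous_lpSymbol η k).memLp_of_hasCompactSupport (hasCompactSupport_lpSymbol η k)

theorem integrable_lpSymbol_mul (h : L2Plane) : Integrable fun ξ ↦ lpSymbol η k ξ * h ξ :=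
  (memLp_lpSymbol_two η k).integrable_mul (Lp.memLp h)

variable {μ : Measure ℝ} {p p' : ℝ → Plane × ℝ} {g g' : ℝ → ℂ}

theorem memLp_lpSymbol_mul_superpose (hp : Measurable p) (hg : Integrable g μ) :
    MemLp (fun ξ ↦ lpSymbol η k ξ * superpose μ p g ξ) 2 :=
  ((continuous_lpSymbol η k).mul (continuous_superpose hp hg)).memLp_of_hasCompactSupport
    (hasCompactSupport_lpSymbol η k).mul_right

/-- The adjoint of sampling the frequency-localized evolution at the points `p s`. -/
def sampleVec (hp : Measurable p) (hg : Integrable g μ) : L2Plane :=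
  (memLp_lpSymbol_mul_superpose η k hp hg).toLp _

variable [SFinite μ]

theorem inner_sampleVec (hp : Measurable p) (hg : Integrable g μ) (h : L2Plane) :
    inner ℂ (sampleVec η k hp hg) h
      = ∫ s, (starRingEnd ℂ) (g s) * waveIntegral (fun ξ ↦ lpSymbol η k ξ * h ξ) (p s) ∂μ := by
  rw [integral_conj_mul_waveIntegral hp hg (integrable_lpSymbol_mul η k h), L2.inner_def]
  refine integral_congr_ae ?_
  filter_upwards [(memLp_lpSymbol_mul_superpose η k hp hg).coeFn_toLp] with ξ hξ
  rw [sampleVec, hξ, RCLike.inner_apply, map_mul, conj_lpSymbol]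
  ring

theorem inner_sampleVec_sampleVec (hp : Measurable p) (hg : Integrable g μ)
    (hp' : Measurable p') (hg' : Integrable g' μ) :
    inner ℂ (sampleVec η k hp hg) (sampleVec η k hp' hg')
      = ∫ s, (starRingEnd ℂ) (g s) * ∫ s', g' s' * lpKernel η k (p s - p' s') ∂μ ∂μ := by
  rw [inner_sampleVec]
  have hi : Integrable fun ξ ↦ lpSymbol η k ξ ^ 2 := by
    simp only [sq]
    exact (memLp_lpSymbol_two η k).integrable_mul (memLp_lpSymbol_two η k)
  refine integral_congr_ae (.of_forall fun s ↦ ?_)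
  simp only [lpKernel]
  rw [← waveIntegral_mul_superpose hp' hg' hi]
  congr 1
  refine integral_congr_ae ?_
  filter_upwards [(memLp_lpSymbol_mul_superpose η k hp' hg').coeFn_toLp] with ξ hξ
  rw [sampleVec, hξ]
  ring

theorem norm_inner_sampleVec_le (hp : Measurable p) (hg : Integrable g μ)
    (hp' : Measurable p') (hg' : Integrable g' μ) {B : ℝ}
    (hB : ∀ s s', ‖lpKernel η k (p s - p' s')‖ ≤ B) :
    ‖(inner ℂ (sampleVec η k hp hg) (sampleVec η k hp' hg') : ℂ)‖
      ≤ B * ((∫ s, ‖g s‖ ∂μ) * ∫ s, ‖g' s‖ ∂μ) := by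
  rw [inner_sampleVec_sampleVec]
  have h1 : ∀ s, ‖∫ s', g' s' * lpKernel η k (p s - p' s') ∂μ‖ ≤ B * ∫ s, ‖g' s‖ ∂μ := by
    intro s
    refine (norm_integral_le_integral_norm _).trans ?_
    rw [← integral_const_mul]
    refine integral_mono_of_nonneg (.of_forall fun _ ↦ norm_nonneg _) (hg'.norm.const_mul B)
      (.of_forall fun s' ↦ ?_)
    simp only [norm_mul]
    rw [mul_comm]
    gcongr
    exact hB s s'
  refine (norm_integral_le_integral_norm _).trans ?_
  calc _ ≤ ∫ s, (B * ∫ s, ‖g' s‖ ∂μ) * ‖g s‖ ∂μ := by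
        refine integral_mono_of_nonneg (.of_forall fun _ ↦ norm_nonneg _) (hg.norm.const_mul _)
          (.of_forall fun s ↦ ?_)
        simp only [norm_mul, RCLike.norm_conj]
        rw [mul_comm]
        gcongr
        exact h1 s
    _ = _ := by rw [integral_const_mul]; ring

/-- Schur test: expand the square with the kernel, use `2ab ≤ a² + b²`, and integrate the symmetric
majorant `κ` in one variable. -/
theorem norm_sampleVec_sq_le [IsFiniteMeasure μ] (hp : Measurable p)
    (hgi : Integrable g μ) (hg2 : Integrable (fun s ↦ ‖g s‖ ^ 2) μ) {κ : ℝ → ℝ → ℝ} {B S : ℝ}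
    (hκm : Continuous (Function.uncurry κ)) (hκB : ∀ s s', κ s s' ≤ B)
    (hκs : ∀ s s', κ s s' = κ s' s) (hκS : ∀ s, ∫ s', κ s s' ∂μ ≤ S)
    (hκ : ∀ s s', ‖lpKernel η k (p s - p s')‖ ≤ κ s s') :
    ‖sampleVec η k hp hgi‖ ^ 2 ≤ S * ∫ s, ‖g s‖ ^ 2 ∂μ := by
  have hκ0 : ∀ s s', 0 ≤ κ s s' := fun s s' ↦ (norm_nonneg _).trans (hκ s s')
  have hκB' : ∀ s s', ‖κ s s'‖ ≤ B := fun s s' ↦ by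
    rw [norm_eq_abs, abs_of_nonneg (hκ0 s s')]; exact hκB s s'
  have i1 : Integrable (fun z : ℝ × ℝ ↦ κ z.1 z.2 * ‖g z.1‖ ^ 2) (μ.prod μ) := by
    have := (hg2.mul_prod (integrable_const (μ := μ) (1 : ℝ)))
    simp only [mul_one] at this
    exact this.bdd_mul hκm.aestronglyMeasurable (.of_forall fun z ↦ hκB' z.1 z.2)
  have i2 : Integrable (fun z : ℝ × ℝ ↦ κ z.1 z.2 * ‖g z.2‖ ^ 2) (μ.prod μ) := by
    refine i1.swap.congr (.of_forall fun z ↦ ?_)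
    simp only [Function.comp, Prod.swap, hκs z.2]
  have n : ‖sampleVec η k hp hgi‖ ^ 2
      = ‖(inner ℂ (sampleVec η k hp hgi) (sampleVec η k hp hgi) : ℂ)‖ := by
    rw [inner_self_eq_norm_sq_to_K, norm_pow, RCLike.norm_ofReal, abs_of_nonneg (norm_nonneg _)]
  rw [n, inner_sampleVec_sampleVec]
  have e1 : ∫ z, κ z.1 z.2 * ‖g z.1‖ ^ 2 ∂(μ.prod μ) ≤ S * ∫ s, ‖g s‖ ^ 2 ∂μ := by
    rw [integral_prod _ i1, ← integral_const_mul]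
    simp only [integral_mul_const]
    refine integral_mono ?_ (hg2.const_mul S) fun s ↦ ?_
    · simpa only [integral_mul_const] using i1.integral_prod_left
    · simp only
      gcongr
      exact hκS s
  have e2 : ∫ z, κ z.1 z.2 * ‖g z.2‖ ^ 2 ∂(μ.prod μ)
      = ∫ z, κ z.1 z.2 * ‖g z.1‖ ^ 2 ∂(μ.prod μ) := by
    rw [← integral_prod_swap]
    simp only [Prod.fst_swap, Prod.snd_swap, hκs]
  have i3 : Integrable (fun z : ℝ × ℝ ↦ (κ z.1 z.2 * ‖g z.1‖ ^ 2 + κ z.1 z.2 * ‖g z.2‖ ^ 2) / 2)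
    (μ.prod μ) := (i1.add i2).div_const 2
  calc _ ≤ ∫ z, (κ z.1 z.2 * ‖g z.1‖ ^ 2 + κ z.1 z.2 * ‖g z.2‖ ^ 2) / 2 ∂(μ.prod μ) := by
        rw [integral_prod _ i3]
        refine (norm_integral_le_integral_norm _).trans ?_
        refine integral_mono_of_nonneg (.of_forall fun _ ↦ norm_nonneg _) i3.integral_prod_left ?_
        filter_upwards [i3.prod_right_ae] with s hs
        rw [← integral_const_mul]
        refine (norm_integral_le_integral_norm _).trans ?_
        refine integral_mono_of_nonneg (.of_forall fun _ ↦ norm_nonneg _) hs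
          (.of_forall fun s' ↦ ?_)
        simp only [norm_mul, RCLike.norm_conj]
        calc ‖g s‖ * (‖g s'‖ * ‖lpKernel η k (p s - p s')‖)
            ≤ ‖g s‖ * (‖g s'‖ * κ s s') := by gcongr; exact hκ s s'
          _ ≤ _ := by nlinarith [mul_nonneg (hκ0 s s') (sq_nonneg (‖g s‖ - ‖g s'‖))]
    _ = ∫ z, κ z.1 z.2 * ‖g z.1‖ ^ 2 ∂(μ.prod μ) := by
        rw [integral_div, integral_add i1 i2, e2]
        ring
    _ ≤ _ := e1

end sampleVec

/-! ### Rotations -/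

theorem continuous_planeRotation (x : Plane) : Continuous fun θ ↦ planeRotation θ x := by
  unfold planeRotation
  fun_prop

theorem norm_planeRotation (θ : ℝ) (x : Plane) : ‖planeRotation θ x‖ = ‖x‖ := by
  rw [← sq_eq_sq₀ (norm_nonneg _) (norm_nonneg _), EuclideanSpace.real_norm_sq_eq,
    EuclideanSpace.real_norm_sq_eq]
  simp [planeRotation, Fin.sum_univ_two]
  linear_combination (x 0 ^ 2 + x 1 ^ 2) * sin_sq_add_cos_sq θ

theorem norm_planeRotation_sub_sq (θ θ' : ℝ) (x : Plane) :
    ‖planeRotation θ x - planeRotation θ' x‖ ^ 2 = ‖x‖ ^ 2 * (2 - 2 * cos (θ - θ')) := by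
  rw [EuclideanSpace.real_norm_sq_eq, EuclideanSpace.real_norm_sq_eq, cos_sub]
  simp [planeRotation, Fin.sum_univ_two]
  linear_combination (x 0 ^ 2 + x 1 ^ 2) * (sin_sq_add_cos_sq θ + sin_sq_add_cos_sq θ')

/-- By periodicity the integral may be taken over `(-π, π]`, where `2 - 2 cos u ≥ (2u/π)²`. The
integrand is then below a Lorentzian of width about `1/ρ`, which supplies the gain in the radius. -/
theorem integral_rotation_kernel_le {ρ : ℝ} (hρ : 0 < ρ) (θ : ℝ) :
    ∫ θ' in Ioc 0 (2 * π), (1 + ρ ^ 2 * (2 - 2 * cos (θ - θ')))⁻¹ ≤ π ^ 2 / (2 * ρ) := by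
  set f : ℝ → ℝ := fun u ↦ (1 + ρ ^ 2 * (2 - 2 * cos u))⁻¹ with hf
  have hden : ∀ u, 0 < 1 + ρ ^ 2 * (2 - 2 * cos u) := fun u ↦ by
    have : 0 ≤ 2 - 2 * cos u := by linarith [cos_le_one u]
    positivity
  have hfc : Continuous f := Continuous.inv₀ (by fun_prop) fun u ↦ (hden u).ne'
  have hper : Function.Periodic f (2 * π) := fun u ↦ by simp [hf]
  set c : ℝ := 2 * ρ / π with hc
  have hc0 : 0 < c := by positivity
  have hgi : Integrable fun u : ℝ ↦ (1 + (c * u) ^ 2)⁻¹ :=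
    integrable_inv_one_add_sq.comp_mul_left' hc0.ne'
  calc ∫ θ' in Ioc 0 (2 * π), f (θ - θ')
      = ∫ θ' in (0 : ℝ)..(2 * π), f (θ - θ') := by
        rw [intervalIntegral.integral_of_le (by positivity)]
    _ = ∫ u in (θ - 2 * π)..(θ - 2 * π + 2 * π), f u := by
        rw [intervalIntegral.integral_comp_sub_left f θ]
        simp
    _ = ∫ u in (-π)..(-π + 2 * π), f u := hper.intervalIntegral_add_eq _ _
    _ = ∫ u in Ioc (-π) π, f u := by
        rw [intervalIntegral.integral_of_le (by linarith [Real.pi_pos])]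
        congr 2
        ring_nf
    _ ≤ ∫ u in Ioc (-π) π, (1 + (c * u) ^ 2)⁻¹ := by
        refine setIntegral_mono_on (hfc.integrableOn_Ioc) hgi.integrableOn measurableSet_Ioc ?_
        intro u hu
        have := cos_le_one_sub_mul_cos_sq (abs_le.2 ⟨hu.1.le, hu.2⟩)
        simp only [hf]
        gcongr
        calc (c * u) ^ 2 = ρ ^ 2 * (2 * (2 / π ^ 2 * u ^ 2)) := by rw [hc]; field_simp
          _ ≤ _ := by gcongr; linarith
    _ ≤ ∫ u, (1 + (c * u) ^ 2)⁻¹ :=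
        setIntegral_le_integral hgi (.of_forall fun u ↦ by positivity)
    _ = π ^ 2 / (2 * ρ) := by
        rw [Measure.integral_comp_mul_left (fun u : ℝ ↦ (1 + u ^ 2)⁻¹), integral_univ_inv_one_add_sq,
          abs_of_pos (by positivity), hc, smul_eq_mul]
        field_simp

/-- The measure `dθ` on `(0, 2π]`. -/
def angleMeasure : Measure ℝ := volume.restrict (Ioc 0 (2 * π))

instance : IsFiniteMeasure angleMeasure := by
  unfold angleMeasure
  infer_instance

theorem angleMeasure_real_univ : angleMeasure.real univ = 2 * π := by
  simp [angleMeasure, Real.pi_pos.le]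

/-- The circle through `x` at time `t`. -/
def orbit (x : Plane) (t : ℝ) (θ : ℝ) : Plane × ℝ := (planeRotation θ x, t)

theorem continuous_orbit (x : Plane) (t : ℝ) : Continuous (orbit x t) :=
  (continuous_planeRotation x).prodMk continuous_const

theorem integrable_angleMeasure {E : Type*} [NormedAddCommGroup E] {f : ℝ → E}
    (hf : Continuous f) : Integrable f angleMeasure :=
  hf.integrableOn_Ioc

theorem sq_integral_le {α : Type*} [MeasurableSpace α] {μ : Measure α} [IsFiniteMeasure μ]
    (hμ : 0 < μ.real univ) {f : α → ℝ} (hf : Integrable f μ) (hf2 : Integrable (fun x ↦ f x ^ 2) μ) :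
    (∫ x, f x ∂μ) ^ 2 ≤ μ.real univ * ∫ x, f x ^ 2 ∂μ := by
  set m := μ.real univ with hm
  set A := ∫ x, f x ∂μ with hA
  have h1 : 0 ≤ ∫ x, (m * f x - A) ^ 2 ∂μ := integral_nonneg fun _ ↦ by positivity
  have e : ∀ x, (m * f x - A) ^ 2 = m ^ 2 * f x ^ 2 - 2 * m * A * f x + A ^ 2 := fun x ↦ by ring
  have h3 : Integrable (fun x ↦ m ^ 2 * f x ^ 2 - 2 * m * A * f x) μ :=
    (hf2.const_mul _).sub (hf.const_mul _)
  simp only [e] at h1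
  rw [integral_add h3 (integrable_const _), integral_sub (hf2.const_mul _) (hf.const_mul _),
    integral_const_mul, integral_const_mul, integral_const, ← hm, ← hA, smul_eq_mul] at h1
  refine le_of_mul_le_mul_left ?_ hμ
  nlinarith

theorem integral_norm_le_sqrt {f : ℝ → ℂ} (hf : Continuous f) :
    ∫ θ, ‖f θ‖ ∂angleMeasure ≤ √(2 * π) * √(∫ θ, ‖f θ‖ ^ 2 ∂angleMeasure) := by
  rw [← Real.sqrt_mul (by positivity)]
  refine Real.le_sqrt_of_sq_le ?_
  have := sq_integral_le (μ := angleMeasure) (f := fun θ ↦ ‖f θ‖)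
    (by rw [angleMeasure_real_univ]; positivity) (integrable_angleMeasure hf.norm)
    (integrable_angleMeasure (hf.norm.pow 2))
  rwa [angleMeasure_real_univ] at this

/-! ### The angularly averaged maximal estimate -/

/-- The energy `∫ |u(A_θ x, t)|² dθ` on a circle. -/
def circleEnergy (u : Plane × ℝ → ℂ) (x : Plane) (t : ℝ) : ℝ :=
  ∫ θ, ‖u (orbit x t θ)‖ ^ 2 ∂angleMeasure

theorem circleEnergy_nonneg (u : Plane × ℝ → ℂ) (x : Plane) (t : ℝ) : 0 ≤ circleEnergy u x t :=
  integral_nonneg fun _ ↦ by positivity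

/-- The frequency-localized evolution of the function with Fourier transform `h`. -/
def localizedWave (η : LPBump) (k : ℤ) (h : L2Plane) : Plane × ℝ → ℂ :=
  waveIntegral fun ξ ↦ lpSymbol η k ξ * h ξ

theorem continuous_localizedWave (η : LPBump) (k : ℤ) (h : L2Plane) :
    Continuous (localizedWave η k h) :=
  continuous_waveIntegral (integrable_lpSymbol_mul η k h)

theorem continuous_localizedWave_orbit (η : LPBump) (k : ℤ) (h : L2Plane) (x : Plane) (t : ℝ) :
    Continuous fun θ ↦ localizedWave η k h (orbit x t θ) :=
  (continuous_localizedWave η k h).comp (continuous_orbit x t)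

/-- The adjoint of sampling on a circle, applied to the evolution itself. -/
def circleVec (η : LPBump) (k : ℤ) (h : L2Plane) (x : Plane) (t : ℝ) : L2Plane :=
  sampleVec η k (continuous_orbit x t).measurable
    (integrable_angleMeasure (continuous_localizedWave_orbit η k h x t))

section circle

variable (η : LPBump) (k : ℤ) (h : L2Plane) (x y : Plane) (t r : ℝ)

/-- `circleVec` is `T*T h` for the operator `T` sampling the circle, so pairing it with `h` gives
`‖T h‖²`. -/
theorem inner_circleVec : inner ℂ (circleVec η k h x t) h
    = (circleEnergy (localizedWave η k h) x t : ℂ) := by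
  rw [circleVec, inner_sampleVec, circleEnergy, ← integral_complex_ofReal]
  refine integral_congr_ae (.of_forall fun θ ↦ ?_)
  simp only [localizedWave]
  rw [mul_comm, RCLike.mul_conj]
  norm_cast

theorem norm_circleVec_sq_le {C : ℝ}
    (hC : ∀ x, (1 + (2 ^ k * ‖x‖) ^ 2) * ‖lpKernel η k (x, 0)‖ ≤ C * (2 ^ k) ^ 2)
    (hC0 : 0 < C) (hx : 0 < ‖x‖) :
    ‖circleVec η k h x t‖ ^ 2
      ≤ C * (2 ^ k) ^ 2 * (π ^ 2 / (2 * (2 ^ k * ‖x‖))) * circleEnergy (localizedWave η k h) x t := by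
  set l : ℝ := 2 ^ k
  have hl : 0 < l := by positivity
  set κ : ℝ → ℝ → ℝ := fun θ θ' ↦ C * l ^ 2 * (1 + (l * ‖x‖) ^ 2 * (2 - 2 * cos (θ - θ')))⁻¹
    with hκ
  have hnn : ∀ u, 0 ≤ 2 - 2 * cos u := fun u ↦ by linarith [cos_le_one u]
  refine norm_sampleVec_sq_le η k _ _
    (integrable_angleMeasure ((continuous_localizedWave_orbit η k h x t).norm.pow 2))
    (κ := κ) (B := C * l ^ 2) ?_ ?_ ?_ ?_ ?_
  · simp only [hκ, Function.uncurry_def]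
    refine continuous_const.mul (Continuous.inv₀ (by fun_prop) fun z ↦ ?_)
    have := hnn (z.1 - z.2)
    positivity
  · intro θ θ'
    refine mul_le_of_le_one_right (by positivity) (inv_le_one_of_one_le₀ ?_)
    have := hnn (θ - θ')
    have : 0 ≤ (l * ‖x‖) ^ 2 * (2 - 2 * cos (θ - θ')) := by positivity
    linarith
  · intro θ θ'
    simp only [hκ]
    rw [← cos_neg, neg_sub]
  · intro θ
    simp only [hκ, integral_const_mul]
    gcongr
    exact integral_rotation_kernel_le (by positivity) θ
  · intro θ θ'
    have e : orbit x t θ - orbit x t θ' = (planeRotation θ x - planeRotation θ' x, 0) := by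
      simp [orbit]
    have := hC (planeRotation θ x - planeRotation θ' x)
    rw [mul_pow, norm_planeRotation_sub_sq, ← mul_assoc, ← mul_pow] at this
    rw [e]
    simp only [hκ]
    have h1 := hnn (θ - θ')
    rw [← div_eq_mul_inv, le_div_iff₀ (by positivity)]
    linarith

/-- Points of the two circles are at least `‖x‖ - ‖y‖` apart whatever the angles, and the kernel
bound used is uniform in time, so `t` and `r` may be unrelated. -/
theorem norm_inner_circleVec_le {C : ℝ}
    (hC : ∀ x t, ‖x‖ * ‖lpKernel η k (x, t)‖ ≤ C * 2 ^ k) (hxy : ‖y‖ < ‖x‖) :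
    ‖(inner ℂ (circleVec η k h x t) (circleVec η k h y r) : ℂ)‖
      ≤ C * 2 ^ k / (‖x‖ - ‖y‖) * (2 * π * (√(circleEnergy (localizedWave η k h) x t) *
        √(circleEnergy (localizedWave η k h) y r))) := by
  have hd : 0 < ‖x‖ - ‖y‖ := sub_pos.2 hxy
  have hB : 0 ≤ C * 2 ^ k / (‖x‖ - ‖y‖) := by
    have := (mul_nonneg (norm_nonneg _) (norm_nonneg _)).trans (hC x t)
    positivity
  refine (norm_inner_sampleVec_le η k _ _ _ _ (B := C * 2 ^ k / (‖x‖ - ‖y‖)) ?_).trans ?_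
  · intro θ θ'
    have h1 : ‖x‖ - ‖y‖ ≤ ‖planeRotation θ x - planeRotation θ' y‖ := by
      have := norm_sub_norm_le (planeRotation θ x) (planeRotation θ' y)
      rwa [norm_planeRotation, norm_planeRotation] at this
    rw [le_div_iff₀ hd]
    have := hC (planeRotation θ x - planeRotation θ' y) (t - r)
    calc _ ≤ ‖lpKernel η k (orbit x t θ - orbit y r θ')‖
          * ‖planeRotation θ x - planeRotation θ' y‖ := by gcongr
      _ ≤ _ := by rw [mul_comm]; exact this
  · refine mul_le_mul_of_nonneg_left ?_ hB
    have a1 := integral_norm_le_sqrt (continuous_localizedWave_orbit η k h x t)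
    have a2 := integral_norm_le_sqrt (continuous_localizedWave_orbit η k h y r)
    calc _ ≤ (√(2 * π) * √(circleEnergy (localizedWave η k h) x t)) *
          (√(2 * π) * √(circleEnergy (localizedWave η k h) y r)) :=
          mul_le_mul a1 a2 (integral_nonneg fun _ ↦ norm_nonneg _) (by positivity)
      _ = √(2 * π) * √(2 * π) * (√(circleEnergy (localizedWave η k h) x t) *
          √(circleEnergy (localizedWave η k h) y r)) := by ring
      _ = _ := by rw [Real.mul_self_sqrt (by positivity)]

end circle

/-- The square function bound over dyadic annuli, with arbitrary circles and times. -/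
theorem exists_sum_circleEnergy_le (η : LPBump) : ∃ C, 0 < C ∧ ∀ (k : ℤ) (h : L2Plane)
    (s : Finset ℕ) (x : ℕ → Plane) (t : ℕ → ℝ),
    (∀ j ∈ s, 2 ^ j ≤ 2 ^ k * ‖x j‖ ∧ 2 ^ k * ‖x j‖ < 2 ^ (j + 1)) →
    ∑ j ∈ s, 2 ^ j * circleEnergy (localizedWave η k h) (x j) (t j)
      ≤ C * (2 ^ k) ^ 2 * ‖h‖ ^ 2 := by
  obtain ⟨C, hC0, hC⟩ := exists_lpKernel_bounds η
  have hs2 : (0 : ℝ) < √2 := by positivity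
  have hs2sq : √2 * √2 = 2 := Real.mul_self_sqrt (by norm_num)
  set ρ : ℝ := (√2)⁻¹ with hρ
  have hρ0 : 0 < ρ := by positivity
  have hρ1 : ρ < 1 := inv_lt_one_of_one_lt₀ (by nlinarith)
  have hρ2 : 1 / 2 ≤ ρ := by
    rw [hρ, one_div]
    gcongr
    nlinarith
  have hρs : ρ * √2 = 1 := inv_mul_cancel₀ hs2.ne'
  refine ⟨20 * C * (2 * (1 - ρ)⁻¹), by have := sub_pos.2 hρ1; positivity, ?_⟩
  intro k h s x t hx
  set l : ℝ := 2 ^ k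
  have hl : 0 < l := by positivity
  set E : ℕ → ℝ := fun j ↦ circleEnergy (localizedWave η k h) (x j) (t j) with hE
  have hE0 : ∀ j, 0 ≤ E j := fun j ↦ circleEnergy_nonneg _ _ _
  set u : ℕ → L2Plane := fun j ↦ circleVec η k h (x j) (t j) with hu
  set q : ℕ → ℝ := fun j ↦ √2 ^ j * √(E j) with hq
  have hq0 : ∀ j, 0 ≤ q j := fun j ↦ by positivity
  have hq2 : ∀ j, q j ^ 2 = 2 ^ j * E j := fun j ↦ by
    simp only [hq]
    rw [mul_pow, Real.sq_sqrt (hE0 j), ← pow_mul, mul_comm j 2, pow_mul, sq, hs2sq]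
  set W : ℕ → ℕ → ℝ := fun i j ↦ 20 * C * l ^ 2 * ρ ^ ((i - j) + (j - i)) with hW
  have hpos : ∀ j ∈ s, 0 < ‖x j‖ := fun j hj ↦ by
    have := (hx j hj).1
    have h2 : (0 : ℝ) < 2 ^ j := by positivity
    exact pos_of_mul_pos_right (h2.trans_le this) hl.le
  -- The Schur bound on a circle of radius about `2^j / l` gains `2^(-j)`; the `5` comes from `π² ≤
  -- 10`.
  have hdiag : ∀ j ∈ s, 2 ^ j * ‖u j‖ ≤ √(5 * C) * l * q j := by
    intro j hj
    refine (sq_le_sq₀ (by positivity) (by have := hq0 j; positivity)).1 ?_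
    have h1 := norm_circleVec_sq_le η k h (x j) (t j) (fun x ↦ (hC k x 0).2) hC0 (hpos j hj)
    have h2 : C * l ^ 2 * (π ^ 2 / (2 * (l * ‖x j‖))) ≤ C * l ^ 2 * (5 / 2 ^ j) := by
      have hj1 := (hx j hj).1
      gcongr C * l ^ 2 * ?_
      rw [div_le_div_iff₀ (by have := hpos j hj; positivity) (by positivity)]
      have : π ^ 2 ≤ 10 := by nlinarith [Real.pi_lt_d2, Real.pi_pos]
      calc π ^ 2 * 2 ^ j ≤ 10 * 2 ^ j := by gcongr
        _ ≤ 10 * (l * ‖x j‖) := by gcongr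
        _ = _ := by ring
    rw [mul_pow, mul_pow, mul_pow, Real.sq_sqrt (by positivity), hq2]
    calc (2 ^ j) ^ 2 * ‖u j‖ ^ 2 ≤ (2 ^ j) ^ 2 * (C * l ^ 2 * (5 / 2 ^ j) * E j) := by
          gcongr
          exact h1.trans (by gcongr; exact hE0 j)
      _ = _ := by field_simp
  -- A gap of two in the index guarantees radial separation at least `2^i / (2l)`. The resulting
  -- factor `2^j` equals `ρ^(i-j)` times the weights `√2^i √2^j` contained in `q i * q j`.
  have hfar : ∀ i ∈ s, ∀ j ∈ s, j + 2 ≤ i →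
      2 ^ i * 2 ^ j * ‖(inner ℂ (u i) (u j) : ℂ)‖ ≤ W i j * (q i * q j) := by
    intro i hi j hj hij
    have hi1 := (hx i hi).1
    have hj1 := (hx j hj).2
    have h2 : (2 : ℝ) ^ (j + 1) ≤ 2 ^ i / 2 := by
      rw [le_div_iff₀ (by norm_num), ← pow_succ]
      exact pow_le_pow_right₀ (by norm_num) (by omega)
    have hd : 2 ^ i / 2 ≤ l * (‖x i‖ - ‖x j‖) := by rw [mul_sub]; linarith
    have h2i : (0 : ℝ) < 2 ^ i := by positivity
    have hlt : 0 < ‖x i‖ - ‖x j‖ := pos_of_mul_pos_right (by linarith) hl.le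
    have h1 := norm_inner_circleVec_le η k h (x i) (x j) (t i) (t j) (fun x t ↦ (hC k x t).1)
      (sub_pos.1 hlt)
    have h3 : C * l / (‖x i‖ - ‖x j‖) ≤ 2 * C * l ^ 2 / 2 ^ i := by
      rw [div_le_div_iff₀ hlt h2i]
      have : 2 ^ i ≤ 2 * (l * (‖x i‖ - ‖x j‖)) := by linarith
      calc C * l * 2 ^ i ≤ C * l * (2 * (l * (‖x i‖ - ‖x j‖))) := by gcongr
        _ = _ := by ring
    obtain ⟨d, rfl⟩ := Nat.exists_eq_add_of_le (show j ≤ i by omega)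
    have e : ρ ^ ((j + d - j) + (j - (j + d))) = ρ ^ d := by congr 1; omega
    have e2 : (2 : ℝ) ^ j = ρ ^ d * (√2 ^ (j + d) * √2 ^ j) := by
      have : ρ ^ d * √2 ^ d = 1 := by rw [← mul_pow, hρs, one_pow]
      rw [pow_add]
      calc (2 : ℝ) ^ j = (ρ ^ d * √2 ^ d) * (√2 * √2) ^ j := by rw [this, hs2sq, one_mul]
        _ = _ := by rw [mul_pow]; ring
    calc _ ≤ 2 ^ (j + d) * 2 ^ j * (2 * C * l ^ 2 / 2 ^ (j + d) *
          (2 * π * (√(E (j + d)) * √(E j)))) := by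
          gcongr
          exact h1.trans (by gcongr)
      _ = 4 * π * (C * l ^ 2 * (√(E (j + d)) * √(E j)) * 2 ^ j) := by field_simp; ring
      _ ≤ 20 * (C * l ^ 2 * (√(E (j + d)) * √(E j)) * 2 ^ j) := by
          gcongr
          linarith [Real.pi_lt_d2]
      _ = _ := by
          simp only [hW, hq, e]
          rw [e2]
          ring
  have hall : ∀ i ∈ s, ∀ j ∈ s,
      2 ^ i * 2 ^ j * ‖(inner ℂ (u i) (u j) : ℂ)‖ ≤ W i j * (q i * q j) := by
    intro i hi j hj
    rcases le_or_gt (j + 2) i with hij | hij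
    · exact hfar i hi j hj hij
    rcases le_or_gt (i + 2) j with hji | hji
    · have := hfar j hj i hi hji
      rw [norm_inner_symm, mul_comm (2 ^ j : ℝ), mul_comm (q j)] at this
      refine this.trans_eq ?_
      simp only [hW]
      rw [add_comm (j - i)]
    -- Neighbouring annuli may not be separated, so Cauchy–Schwarz and the diagonal bound are used;
    -- the lost decay is at most one factor `ρ ≥ 1/2`.
    · have h1 : ρ ^ 1 ≤ ρ ^ ((i - j) + (j - i)) :=
        pow_le_pow_of_le_one hρ0.le hρ1.le (by omega)
      have h2 := norm_inner_le_norm (𝕜 := ℂ) (u i) (u j)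
      have hqq : 0 ≤ q i * q j := mul_nonneg (hq0 i) (hq0 j)
      calc _ ≤ 2 ^ i * 2 ^ j * (‖u i‖ * ‖u j‖) := by gcongr
        _ = (2 ^ i * ‖u i‖) * (2 ^ j * ‖u j‖) := by ring
        _ ≤ (√(5 * C) * l * q i) * (√(5 * C) * l * q j) :=
          mul_le_mul (hdiag i hi) (hdiag j hj) (by positivity) (by have := hq0 i; positivity)
        _ = (√(5 * C) * √(5 * C)) * l ^ 2 * (q i * q j) := by ring
        _ = 5 * C * l ^ 2 * (q i * q j) := by rw [Real.mul_self_sqrt (by positivity)]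
        _ ≤ W i j * (q i * q j) := by
          gcongr
          simp only [hW]
          have : 0 < C * l ^ 2 := by positivity
          nlinarith
  -- The factor `2^j` on each vector turns its pairing with `h` into the weighted energy `q j ^ 2`.
  have key := sum_sq_le_of_almost_orthogonal s h (fun j ↦ ((2 ^ j : ℝ) : ℂ) • u j) q W
    (S := 20 * C * l ^ 2 * (2 * (1 - ρ)⁻¹)) (by have := sub_pos.2 hρ1; positivity)
    (by
      intro j _
      rw [inner_smul_left, inner_circleVec, hq2, Complex.conj_ofReal]
      push_cast
      rfl)
    (by intro i j; simp only [hW]; rw [add_comm])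
    (by intro i j; positivity)
    (by
      intro i _
      rw [← Finset.mul_sum]
      gcongr
      exact sum_pow_dist_le s i hρ0.le hρ1)
    (by
      intro i hi j hj
      rw [inner_smul_left, inner_smul_right, norm_mul, norm_mul, RCLike.norm_conj,
        Complex.norm_real, Complex.norm_real, norm_of_nonneg (by positivity),
        norm_of_nonneg (by positivity), ← mul_assoc]
      exact hall i hi j hj)
  simp only [hq2] at key
  refine key.trans_eq ?_
  ring

/-! ### The maximal estimate -/

theorem eLpNorm_two_sq {α E : Type*} [MeasurableSpace α] [TopologicalSpace E]
    [ContinuousENorm E] (f : α → E) (μ : Measure α) :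
    eLpNorm f 2 μ ^ 2 = ∫⁻ x, ‖f x‖ₑ ^ 2 ∂μ := by
  have := eLpNorm_nnreal_pow_eq_lintegral (f := f) (μ := μ) (p := 2) two_ne_zero
  simpa using this

theorem angularNorm_sq_eq {F : Plane → ℝ → ℂ} {u : Plane × ℝ → ℂ} (hF : ∀ x t, F x t = u (x, t))
    (hu : Continuous u) (x : Plane) (t : ℝ) :
    angularNorm 2 F x t ^ 2 = ENNReal.ofReal (circleEnergy u x t) := by
  have hc : Continuous fun θ ↦ ‖u (orbit x t θ)‖ ^ 2 :=
    ((hu.comp (continuous_orbit x t)).norm.pow 2)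
  rw [angularNorm, eLpNorm_two_sq, circleEnergy,
    ofReal_integral_eq_lintegral_ofReal (integrable_angleMeasure hc)
      (.of_forall fun _ ↦ by positivity)]
  refine lintegral_congr fun θ ↦ ?_
  rw [hF, ENNReal.ofReal_pow (norm_nonneg _), ofReal_norm]
  rfl

/-- A Bernstein bound obtained from the same adjoint: sampling at one point is integration against a
Dirac mass, and the norm of its vector is controlled by the kernel at the origin. -/
theorem norm_localizedWave_sq_le (η : LPBump) (k : ℤ) (h : L2Plane) {C : ℝ}
    (hC : ∀ x, (1 + (2 ^ k * ‖x‖) ^ 2) * ‖lpKernel η k (x, 0)‖ ≤ C * (2 ^ k) ^ 2)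
    (p : Plane × ℝ) : ‖localizedWave η k h p‖ ^ 2 ≤ C * (2 ^ k) ^ 2 * ‖h‖ ^ 2 := by
  have hp : Measurable fun _ : ℝ ↦ p := measurable_const
  have hg : Integrable (fun _ : ℝ ↦ (1 : ℂ)) (Measure.dirac 0) := integrable_const _
  have e := inner_sampleVec η k hp hg h
  simp only [map_one, one_mul, integral_dirac] at e
  have n : ‖sampleVec η k hp hg‖ ^ 2 ≤ C * (2 ^ k) ^ 2 := by
    have h1 := norm_inner_sampleVec_le η k hp hg hp hg (B := C * (2 ^ k) ^ 2) (fun _ _ ↦ by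
      have := hC 0
      rw [sub_self, ← Prod.mk_zero_zero]
      simpa using this)
    rw [inner_self_eq_norm_sq_to_K, norm_pow, RCLike.norm_ofReal,
      abs_of_nonneg (norm_nonneg _)] at h1
    simpa using h1
  have h2 := norm_inner_le_norm (𝕜 := ℂ) (sampleVec η k hp hg) h
  rw [e] at h2
  calc ‖localizedWave η k h p‖ ^ 2 ≤ (‖sampleVec η k hp hg‖ * ‖h‖) ^ 2 := by
        gcongr
        exact h2
    _ = ‖sampleVec η k hp hg‖ ^ 2 * ‖h‖ ^ 2 := by ring
    _ ≤ _ := by gcongr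

theorem circleEnergy_le (η : LPBump) (k : ℤ) (h : L2Plane) {C : ℝ}
    (hC : ∀ x, (1 + (2 ^ k * ‖x‖) ^ 2) * ‖lpKernel η k (x, 0)‖ ≤ C * (2 ^ k) ^ 2)
    (x : Plane) (t : ℝ) :
    circleEnergy (localizedWave η k h) x t ≤ 2 * π * (C * (2 ^ k) ^ 2 * ‖h‖ ^ 2) := by
  calc circleEnergy (localizedWave η k h) x t
      ≤ ∫ _, C * (2 ^ k) ^ 2 * ‖h‖ ^ 2 ∂angleMeasure :=
        integral_mono
          (integrable_angleMeasure ((continuous_localizedWave_orbit η k h x t).norm.pow 2))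
          (integrable_const _) fun θ ↦ norm_localizedWave_sq_le η k h hC _
    _ = _ := by rw [integral_const, angleMeasure_real_univ, smul_eq_mul]

/-- The largest energy on a circle of radius between `2^j / l` and `2^(j+1) / l`. -/
def annulusSup (u : Plane × ℝ → ℂ) (l : ℝ) (j : ℕ) : ℝ≥0∞ :=
  ⨆ (z : Plane × ℝ) (_ : 2 ^ j ≤ l * ‖z.1‖ ∧ l * ‖z.1‖ < 2 ^ (j + 1)),
    ENNReal.ofReal (circleEnergy u z.1 z.2)

theorem exists_tsum_annulusSup_le (η : LPBump) : ∃ C, 0 < C ∧ ∀ (k : ℤ) (h : L2Plane),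
    ∑' j, 2 ^ j * annulusSup (localizedWave η k h) (2 ^ k) j
      ≤ ENNReal.ofReal (C * (2 ^ k) ^ 2 * ‖h‖ ^ 2) := by
  obtain ⟨C₀, hC₀, hK⟩ := exists_lpKernel_bounds η
  obtain ⟨C, hC, hsum⟩ := exists_sum_circleEnergy_le η
  refine ⟨2 * C, by positivity, fun k h ↦ ?_⟩
  set l : ℝ := 2 ^ k
  have hl : 0 < l := by positivity
  set u := localizedWave η k h
  have hfin : ∀ j, annulusSup u l j ≠ ⊤ := by
    intro j
    refine ne_top_of_le_ne_top (b := ENNReal.ofReal (2 * π * (C₀ * l ^ 2 * ‖h‖ ^ 2)))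
      ENNReal.ofReal_ne_top ?_
    refine iSup₂_le fun z _ ↦ ENNReal.ofReal_le_ofReal ?_
    exact circleEnergy_le η k h (fun x ↦ (hK k x 0).2) _ _
  -- The supremum need not be attained. Since it is finite, a point with at least half its value
  -- exists; if it vanishes, any point of the annulus serves.
  have hex : ∀ j, ∃ z : Plane × ℝ, (2 ^ j ≤ l * ‖z.1‖ ∧ l * ‖z.1‖ < 2 ^ (j + 1)) ∧
      annulusSup u l j ≤ 2 * ENNReal.ofReal (circleEnergy u z.1 z.2) := by
    intro j
    rcases eq_or_ne (annulusSup u l j) 0 with h0 | h0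
    · refine ⟨(PiLp.single 2 (0 : Fin 2) (2 ^ j / l), 0), ?_, by simp [h0]⟩
      have e : l * ‖(PiLp.single 2 (0 : Fin 2) (2 ^ j / l) : Plane)‖ = 2 ^ j := by
        rw [PiLp.norm_single, norm_of_nonneg (by positivity)]
        field_simp
      rw [e]
      exact ⟨le_rfl, pow_lt_pow_right₀ (by norm_num) (by omega)⟩
    · have hlt : annulusSup u l j / 2 < annulusSup u l j := ENNReal.half_lt_self h0 (hfin j)
      conv_rhs at hlt => rw [annulusSup]
      obtain ⟨z, hz⟩ := lt_iSup_iff.1 hlt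
      obtain ⟨hz1, hz2⟩ := lt_iSup_iff.1 hz
      refine ⟨z, hz1, ?_⟩
      rw [mul_comm]
      exact (ENNReal.div_le_iff (by simp) (by simp)).1 hz2.le
  choose z hz1 hz2 using hex
  rw [ENNReal.tsum_eq_iSup_sum]
  refine iSup_le fun s ↦ ?_
  calc ∑ j ∈ s, 2 ^ j * annulusSup u l j
      ≤ ∑ j ∈ s, ENNReal.ofReal (2 * (2 ^ j * circleEnergy u (z j).1 (z j).2)) := by
        gcongr with j _
        rw [ENNReal.ofReal_mul (by norm_num), ENNReal.ofReal_mul (by positivity),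
          ENNReal.ofReal_pow (by norm_num), ENNReal.ofReal_ofNat, mul_left_comm]
        gcongr
        exact hz2 j
    _ = ENNReal.ofReal (2 * ∑ j ∈ s, 2 ^ j * circleEnergy u (z j).1 (z j).2) := by
        rw [Finset.mul_sum, ENNReal.ofReal_sum_of_nonneg]
        intro j _
        have := circleEnergy_nonneg u (z j).1 (z j).2
        positivity
    _ ≤ _ := by
        refine ENNReal.ofReal_le_ofReal ?_
        have := hsum k h s (fun j ↦ (z j).1) (fun j ↦ (z j).2) fun j _ ↦ hz1 j
        linarith

/-- Since `|x₁| ≤ ‖x‖`, the annulus containing the point can contribute only for `x₁` in the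
interval of its outer radius. The right side no longer involves `x₂` or `t`. -/
theorem circleEnergy_le_step (u : Plane × ℝ → ℂ) {l : ℝ} (hl : 0 < l) {T : ℝ≥0∞}
    (hT : ∀ x t, ENNReal.ofReal (circleEnergy u x t) ≤ T) (x₁ x₂ t : ℝ) :
    ENNReal.ofReal (circleEnergy u !₂[x₁, x₂] t)
      ≤ (Ioo (-(1 / l)) (1 / l)).indicator (fun _ ↦ T) x₁
        + ∑' j : ℕ, (Ioo (-(2 ^ (j + 1) / l)) (2 ^ (j + 1) / l)).indicator
            (fun _ ↦ annulusSup u l j) x₁ := by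
  set x : Plane := !₂[x₁, x₂] with hx
  have hx1 : |x₁| ≤ ‖x‖ := by
    have := PiLp.norm_apply_le x 0
    simpa [hx] using this
  have hmem : ∀ r, l * ‖x‖ < r → x₁ ∈ Ioo (-(r / l)) (r / l) := by
    intro r hr
    rw [mem_Ioo, ← abs_lt]
    rw [mul_comm] at hr
    exact hx1.trans_lt ((lt_div_iff₀ hl).2 hr)
  rcases lt_or_ge (l * ‖x‖) 1 with h | h
  · rw [indicator_of_mem (hmem 1 h)]
    exact (hT x t).trans le_self_add
  · obtain ⟨j, hj1, hj2⟩ := exists_nat_pow_near h (one_lt_two)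
    refine le_trans ?_ le_add_self
    refine le_trans ?_ (ENNReal.le_tsum j)
    rw [indicator_of_mem (hmem _ hj2)]
    exact le_iSup₂ (f := fun (z : Plane × ℝ)
      (_ : 2 ^ j ≤ l * ‖z.1‖ ∧ l * ‖z.1‖ < 2 ^ (j + 1)) ↦
        ENNReal.ofReal (circleEnergy u z.1 z.2)) (x, t) ⟨hj1, hj2⟩

theorem exists_angular_maximal_estimate (η : LPBump) :
    ∃ C : ℝ, 0 < C ∧ ∀ (k : ℤ) (u₀ : L2Plane),
      anisotropicNorm 2 ∞ (angularNorm 2 (freeEvolution η k u₀))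
        ≤ ENNReal.ofReal (C * (2 : ℝ) ^ ((k : ℝ) / 2) * ‖u₀‖) := by
  obtain ⟨C₀, hC₀, hK⟩ := exists_lpKernel_bounds η
  obtain ⟨C, hC, hsum⟩ := exists_tsum_annulusSup_le η
  -- The core has `x₁`-length `2 / l` and energy at most `2π C₀ l² ‖h‖²`; the `j`-th annulus has
  -- `x₁`-length `(4 / l) 2^j`.
  refine ⟨√(4 * π * C₀ + 4 * C), by positivity, fun k u₀ ↦ ?_⟩
  set h : L2Plane := 𝓕 u₀ with hh
  have hn : ‖h‖ = ‖u₀‖ := Lp.norm_fourier_eq u₀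
  set l : ℝ := 2 ^ k with hl_def
  have hl : 0 < l := by positivity
  set u := localizedWave η k h with hu
  have hF : ∀ x t, freeEvolution η k u₀ x t = u (x, t) :=
    fun x t ↦ freeEvolution_eq_waveIntegral η k u₀ x t
  set T : ℝ≥0∞ := ENNReal.ofReal (2 * π * (C₀ * l ^ 2 * ‖h‖ ^ 2))
  have hT : ∀ x t, ENNReal.ofReal (circleEnergy u x t) ≤ T := fun x t ↦
    ENNReal.ofReal_le_ofReal (circleEnergy_le η k h (fun x ↦ (hK k x 0).2) _ _)
  have hsup : ∀ x₁ : ℝ, ‖eLpNorm (fun z : ℝ × ℝ ↦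
      angularNorm 2 (freeEvolution η k u₀) !₂[x₁, z.1] z.2) ∞ volume‖ₑ ^ 2
      ≤ (Ioo (-(1 / l)) (1 / l)).indicator (fun _ ↦ T) x₁
        + ∑' j : ℕ, (Ioo (-(2 ^ (j + 1) / l)) (2 ^ (j + 1) / l)).indicator
            (fun _ ↦ annulusSup u l j) x₁ := by
    intro x₁
    set G := (Ioo (-(1 / l)) (1 / l)).indicator (fun _ ↦ T) x₁
        + ∑' j : ℕ, (Ioo (-(2 ^ (j + 1) / l)) (2 ^ (j + 1) / l)).indicator
            (fun _ ↦ annulusSup u l j) x₁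
    have h1 : eLpNorm (fun z : ℝ × ℝ ↦
        angularNorm 2 (freeEvolution η k u₀) !₂[x₁, z.1] z.2) ∞ volume ≤ G ^ (1 / 2 : ℝ) := by
      rw [eLpNorm_exponent_top]
      refine eLpNormEssSup_le_of_ae_enorm_bound (.of_forall fun z ↦ ?_)
      have h2 := circleEnergy_le_step u hl hT x₁ z.1 z.2
      rw [← angularNorm_sq_eq hF (continuous_localizedWave η k h)] at h2
      rw [enorm_eq_self]
      calc _ = ((angularNorm 2 (freeEvolution η k u₀) !₂[x₁, z.1] z.2) ^ (2 : ℕ)) ^ (1 / 2 : ℝ) := by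
            rw [← ENNReal.rpow_natCast, ← ENNReal.rpow_mul]
            simp
        _ ≤ _ := by gcongr
    rw [enorm_eq_self]
    calc _ ≤ (G ^ (1 / 2 : ℝ)) ^ 2 := by gcongr
      _ = G := by
        rw [← ENNReal.rpow_natCast, ← ENNReal.rpow_mul]
        simp
  have hsq : anisotropicNorm 2 ∞ (angularNorm 2 (freeEvolution η k u₀)) ^ 2
      ≤ ENNReal.ofReal ((√(4 * π * C₀ + 4 * C) * (2 : ℝ) ^ ((k : ℝ) / 2) * ‖u₀‖) ^ 2) := by
    rw [anisotropicNorm, eLpNorm_two_sq]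
    refine (lintegral_mono hsup).trans ?_
    rw [lintegral_add_left (by measurability), lintegral_tsum
      (fun j ↦ (measurable_const.indicator measurableSet_Ioo).aemeasurable)]
    simp only [lintegral_indicator_const measurableSet_Ioo, Real.volume_Ioo]
    have e1 : T * ENNReal.ofReal (1 / l - -(1 / l))
        = ENNReal.ofReal (4 * π * C₀ * l * ‖h‖ ^ 2) := by
      rw [← ENNReal.ofReal_mul (by positivity)]
      congr 1
      field_simp
      ring
    have e2 : ∀ j : ℕ, annulusSup u l j * ENNReal.ofReal (2 ^ (j + 1) / l - -(2 ^ (j + 1) / l))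
        = ENNReal.ofReal (4 / l) * (2 ^ j * annulusSup u l j) := by
      intro j
      have : (2 : ℝ) ^ (j + 1) / l - -(2 ^ (j + 1) / l) = 4 / l * 2 ^ j := by
        field_simp
        ring
      rw [this, ENNReal.ofReal_mul (by positivity), ENNReal.ofReal_pow (by norm_num),
        ENNReal.ofReal_ofNat]
      ring
    rw [e1]
    simp only [e2]
    rw [ENNReal.tsum_mul_left]
    calc _ ≤ ENNReal.ofReal (4 * π * C₀ * l * ‖h‖ ^ 2)
          + ENNReal.ofReal (4 / l) * ENNReal.ofReal (C * l ^ 2 * ‖h‖ ^ 2) := by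
          gcongr
          exact hsum k h
      _ = _ := by
          rw [← ENNReal.ofReal_mul (by positivity), ← ENNReal.ofReal_add (by positivity)
            (by positivity), mul_pow, mul_pow, Real.sq_sqrt (by positivity), hn]
          congr 1
          have : ((2 : ℝ) ^ ((k : ℝ) / 2)) ^ 2 = l := by
            rw [← Real.rpow_natCast, ← Real.rpow_mul (by norm_num), hl_def, ← Real.rpow_intCast]
            simp
          rw [this]
          field_simp
  rw [ENNReal.ofReal_pow (by positivity)] at hsq
  exact (ENNReal.pow_le_pow_left_iff two_ne_zero).1 hsq

/-! ### A lacunary curve -/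

/-- Removing the first term rescales `τ` to `τ / 2`, so induction applies. The piecewise bound,
stronger than the linear bound `6τ` needed later, is what lets the induction close near `τ = 1`. -/
theorem sum_two_pow_mul_min_le (J : ℕ) : ∀ τ : ℝ, 0 ≤ τ →
    ∑ j ∈ Finset.range J, 2 ^ j * min 2 (τ ^ 2 / 4 ^ j)
      ≤ if τ ≤ 1 then 2 * τ ^ 2 else 6 * τ - 4 := by
  induction J with
  | zero =>
    intro τ hτ
    rw [Finset.sum_range_zero]
    split_ifs with h
    · positivity
    · linarith
  | succ J ih =>
    intro τ hτ
    rw [Finset.sum_range_succ']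
    have e : ∑ j ∈ Finset.range J, (2 : ℝ) ^ (j + 1) * min 2 (τ ^ 2 / 4 ^ (j + 1))
        = 2 * ∑ j ∈ Finset.range J, 2 ^ j * min 2 ((τ / 2) ^ 2 / 4 ^ j) := by
      rw [Finset.mul_sum]
      refine Finset.sum_congr rfl fun j _ ↦ ?_
      rw [show τ ^ 2 / 4 ^ (j + 1) = (τ / 2) ^ 2 / 4 ^ j by field_simp; ring]
      ring
    rw [e]
    have h1 := ih (τ / 2) (by positivity)
    have m1 : min 2 (τ ^ 2) ≤ 2 := min_le_left _ _
    have m2 : min 2 (τ ^ 2) ≤ τ ^ 2 := min_le_right _ _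
    simp only [pow_zero, one_mul, div_one]
    split_ifs at h1 ⊢ with h2 h3 h3
    · linarith
    · linarith
    · have h4 : 0 ≤ (τ - 1) * (2 - τ) := mul_nonneg (by linarith) (by linarith)
      rcases le_or_gt τ (3 / 2) with h5 | h5
      · nlinarith
      · have h6 : 0 ≤ (τ - 3 / 2) * (2 - τ) := mul_nonneg (by linarith) (by linarith)
        nlinarith
    · linarith

/-- A lacunary trigonometric sum, Hölder continuous of exponent `1/2`. -/
def lacunary (J : ℕ) (D s : ℝ) : ℝ :=
  ∑ j ∈ Finset.range J, D * 2 ^ j / 6 * cos (s / (D ^ 2 * 4 ^ j))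

theorem continuous_lacunary (J : ℕ) (D : ℝ) : Continuous (lacunary J D) := by
  unfold lacunary
  fun_prop

/-- Each cosine difference is at most both `2` and its phase increment: slow modes are estimated by
their slope and fast ones by their size, the crossover being at `4^j ≈ |s - s'| / D²`. -/
theorem lacunary_sub_sq_le (J : ℕ) {D : ℝ} (hD : 0 < D) (s s' : ℝ) :
    (lacunary J D s - lacunary J D s') ^ 2 ≤ |s - s'| := by
  set τ := √|s - s'| / D with hτ
  have hτ0 : 0 ≤ τ := by positivity
  have hτ2 : τ ^ 2 = |s - s'| / D ^ 2 := by rw [hτ, div_pow, Real.sq_sqrt (abs_nonneg _)]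
  have hle : |lacunary J D s - lacunary J D s'| ≤ √|s - s'| := by
    rw [lacunary, lacunary, ← Finset.sum_sub_distrib]
    calc _ ≤ ∑ j ∈ Finset.range J, D / 6 * (2 ^ j * min 2 (τ ^ 2 / 4 ^ j)) := by
          refine (Finset.abs_sum_le_sum_abs _ _).trans (Finset.sum_le_sum fun j _ ↦ ?_)
          rw [← mul_sub, abs_mul, abs_of_pos (by positivity)]
          calc D * 2 ^ j / 6 * |cos (s / (D ^ 2 * 4 ^ j)) - cos (s' / (D ^ 2 * 4 ^ j))|
              ≤ D * 2 ^ j / 6 * min 2 (τ ^ 2 / 4 ^ j) := by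
                gcongr
                refine le_min ?_ ?_
                · rw [abs_le]
                  constructor <;> linarith [cos_le_one (s / (D ^ 2 * 4 ^ j)),
                    neg_one_le_cos (s / (D ^ 2 * 4 ^ j)), cos_le_one (s' / (D ^ 2 * 4 ^ j)),
                    neg_one_le_cos (s' / (D ^ 2 * 4 ^ j))]
                · refine (Real.abs_cos_sub_cos_le _ _).trans_eq ?_
                  rw [← sub_div, abs_div, abs_of_pos (by positivity : 0 < D ^ 2 * 4 ^ j), hτ2,
                    div_div]
            _ = _ := by ring
      _ ≤ D / 6 * (6 * τ) := by
          rw [← Finset.mul_sum]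
          gcongr
          refine (sum_two_pow_mul_min_le J τ hτ0).trans ?_
          split_ifs with h
          · nlinarith
          · linarith
      _ = √|s - s'| := by rw [hτ]; field_simp
  calc _ = |lacunary J D s - lacunary J D s'| ^ 2 := (sq_abs _).symm
    _ ≤ √|s - s'| ^ 2 := by gcongr
    _ = _ := Real.sq_sqrt (abs_nonneg _)

/-! ### Orthogonality of the lacunary modes over a common period -/

theorem integral_cos_full_period {N : ℝ} (hN : N ≠ 0) {m : ℤ} (hm : m ≠ 0) (c : ℝ) :
    ∫ s in (0 : ℝ)..N, cos (2 * π * m / N * s + c) = 0 := by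
  have hm' : (m : ℝ) ≠ 0 := by exact_mod_cast hm
  have h : 2 * π * m / N ≠ 0 := by positivity
  rw [intervalIntegral.integral_comp_mul_add (fun x ↦ cos x) h, integral_cos]
  have e : 2 * π * m / N * N + c = c + m * (2 * π) := by field_simp; ring
  rw [e, sin_add_int_mul_two_pi]
  simp

theorem integral_sin_mul_sin {N : ℝ} (hN : N ≠ 0) {m n : ℕ} (hn : m ≠ 0 ∨ n ≠ 0) (a b : ℝ) :
    ∫ s in (0 : ℝ)..N, sin (2 * π * m / N * s + a) * sin (2 * π * n / N * s + b)
      = if m = n then N / 2 * cos (a - b) else 0 := by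
  have e : ∀ s, sin (2 * π * m / N * s + a) * sin (2 * π * n / N * s + b)
      = (cos (2 * π * ((m - n : ℤ) : ℝ) / N * s + (a - b))
        - cos (2 * π * ((m + n : ℤ) : ℝ) / N * s + (a + b))) / 2 := by
    intro s
    have h1 : 2 * π * ((m - n : ℤ) : ℝ) / N * s + (a - b)
        = (2 * π * m / N * s + a) - (2 * π * n / N * s + b) := by push_cast; ring
    have h2 : 2 * π * ((m + n : ℤ) : ℝ) / N * s + (a + b)
        = (2 * π * m / N * s + a) + (2 * π * n / N * s + b) := by push_cast; ring
    rw [h1, h2]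
    generalize 2 * π * m / N * s + a = A
    generalize 2 * π * n / N * s + b = B
    rw [cos_sub, cos_add]
    ring
  simp only [e]
  rw [intervalIntegral.integral_div, intervalIntegral.integral_sub
    (Continuous.intervalIntegrable (by fun_prop) _ _)
    (Continuous.intervalIntegrable (by fun_prop) _ _),
    integral_cos_full_period hN (m := (m + n : ℤ)) (by omega)]
  split_ifs with h
  · subst h
    simp
    ring
  · rw [integral_cos_full_period hN (m := (m - n : ℤ)) (by omega)]
    simp

theorem lacunary_add_sub (J : ℕ) (D s σ : ℝ) : lacunary J D (s + σ) - lacunary J D s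
    = ∑ j ∈ Finset.range J, -(D * 2 ^ j / 3 * sin (σ / (2 * (D ^ 2 * 4 ^ j)))) *
        sin (s / (D ^ 2 * 4 ^ j) + σ / (2 * (D ^ 2 * 4 ^ j))) := by
  rw [lacunary, lacunary, ← Finset.sum_sub_distrib]
  refine Finset.sum_congr rfl fun j _ ↦ ?_
  rw [← mul_sub, cos_sub_cos]
  have e1 : ((s + σ) / (D ^ 2 * 4 ^ j) + s / (D ^ 2 * 4 ^ j)) / 2
      = s / (D ^ 2 * 4 ^ j) + σ / (2 * (D ^ 2 * 4 ^ j)) := by ring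
  have e2 : ((s + σ) / (D ^ 2 * 4 ^ j) - s / (D ^ 2 * 4 ^ j)) / 2
      = σ / (2 * (D ^ 2 * 4 ^ j)) := by ring
  rw [e1, e2]
  ring

theorem integral_lacunary_add_sub_sq (J : ℕ) {D : ℝ} (hD : 0 < D) (σ : ℝ) :
    ∫ s in (0 : ℝ)..(2 * π * D ^ 2 * 4 ^ J), (lacunary J D (s + σ) - lacunary J D s) ^ 2
      = ∑ j ∈ Finset.range J, 2 * π * D ^ 2 * 4 ^ J / 18 * (D ^ 2 * 4 ^ j) *
          sin (σ / (2 * (D ^ 2 * 4 ^ j))) ^ 2 := by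
  set N := 2 * π * D ^ 2 * 4 ^ J with hN
  have hN0 : N ≠ 0 := by positivity
  set c : ℕ → ℝ := fun j ↦ -(D * 2 ^ j / 3 * sin (σ / (2 * (D ^ 2 * 4 ^ j)))) with hc
  set θ : ℕ → ℝ := fun j ↦ σ / (2 * (D ^ 2 * 4 ^ j)) with hθ
  -- `N` is a common period of all modes: mode `j` has the integer frequency `4 ^ (J - j)`, and
  -- these are nonzero and distinct, so cross terms vanish.
  have hfreq : ∀ j ∈ Finset.range J, ∀ s : ℝ,
      s / (D ^ 2 * 4 ^ j) = 2 * π * ((4 ^ (J - j) : ℕ) : ℝ) / N * s := by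
    intro j hj s
    have hjJ : (4 : ℝ) ^ J = 4 ^ (J - j) * 4 ^ j := by
      rw [← pow_add, Nat.sub_add_cancel (Finset.mem_range.1 hj).le]
    rw [hN, hjJ]
    push_cast
    field_simp
  have e : ∀ s, (lacunary J D (s + σ) - lacunary J D s) ^ 2
      = ∑ i ∈ Finset.range J, ∑ j ∈ Finset.range J, c i * c j *
        (sin (2 * π * ((4 ^ (J - i) : ℕ) : ℝ) / N * s + θ i)
          * sin (2 * π * ((4 ^ (J - j) : ℕ) : ℝ) / N * s + θ j)) := by
    intro s
    rw [lacunary_add_sub, sq, Finset.sum_mul_sum]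
    refine Finset.sum_congr rfl fun i hi ↦ Finset.sum_congr rfl fun j hj ↦ ?_
    rw [hfreq i hi, hfreq j hj]
    ring
  simp only [e]
  have hci : ∀ i j, Continuous fun s ↦ c i * c j *
        (sin (2 * π * ((4 ^ (J - i) : ℕ) : ℝ) / N * s + θ i)
          * sin (2 * π * ((4 ^ (J - j) : ℕ) : ℝ) / N * s + θ j)) := fun i j ↦ by fun_prop
  rw [intervalIntegral.integral_finsetSum fun i _ ↦
    (continuous_finsetSum _ fun j _ ↦ hci i j).intervalIntegrable _ _]
  refine Finset.sum_congr rfl fun i hi ↦ ?_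
  rw [intervalIntegral.integral_finsetSum fun j _ ↦ (hci i j).intervalIntegrable _ _]
  rw [Finset.sum_eq_single_of_mem i hi]
  · rw [intervalIntegral.integral_const_mul, integral_sin_mul_sin hN0 (by simp), if_pos rfl]
    simp only [sub_self, cos_zero, hc]
    rw [show (4 : ℝ) ^ i = 2 ^ i * 2 ^ i by rw [← mul_pow]; norm_num]
    ring
  · intro j hj hji
    rw [intervalIntegral.integral_const_mul, integral_sin_mul_sin hN0 (by simp), if_neg, mul_zero]
    intro h
    have := Nat.pow_right_injective (le_refl 2 |>.trans (by norm_num : 2 ≤ 4)) h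
    have h1 := Finset.mem_range.1 hi
    have h2 := Finset.mem_range.1 hj
    omega

/-- The logarithmic divergence: every scale contributes equally. -/
theorem integral_lacunary_lower (J : ℕ) {D : ℝ} (hD : 0 < D) :
    2 * π * D ^ 2 * 4 ^ J * J / 36864 ≤
      ∫ σ in Ioc (D ^ 2) (2 * π * D ^ 2 * 4 ^ J),
        (∫ s in (0 : ℝ)..(2 * π * D ^ 2 * 4 ^ J), (lacunary J D (s + σ) - lacunary J D s) ^ 2)
          / (32 * σ ^ 2) := by
  simp only [integral_lacunary_add_sub_sq J hD, Finset.sum_div]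
  set N := 2 * π * D ^ 2 * 4 ^ J with hN
  have hN0 : 0 < N := by positivity
  set f : ℕ → ℝ → ℝ := fun j σ ↦
    N / 18 * (D ^ 2 * 4 ^ j) * sin (σ / (2 * (D ^ 2 * 4 ^ j))) ^ 2 / (32 * σ ^ 2) with hf
  have hfi : ∀ j, IntegrableOn (f j) (Ioc (D ^ 2) N) := by
    intro j
    refine IntegrableOn.mono_set (ContinuousOn.integrableOn_Icc ?_) Ioc_subset_Icc_self
    refine ContinuousOn.div (by fun_prop) (by fun_prop) fun σ hσ ↦ ?_
    have : 0 < σ := (by positivity : 0 < D ^ 2).trans_le hσ.1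
    positivity
  rw [integral_finsetSum _ fun j _ ↦ hfi j]
  have hj : ∀ j ∈ Finset.range J, N / 36864 ≤ ∫ σ in Ioc (D ^ 2) N, f j σ := by
    intro j hj
    -- Mode `j` is tested at its own scale `b < σ ≤ 2b`, where the sine is at least `1/4`. The
    -- contribution `N / (18 · 16 · 128)` does not depend on `j`.
    set b := D ^ 2 * 4 ^ j with hb
    have hb0 : 0 < b := by positivity
    have h4j : (1 : ℝ) ≤ 4 ^ j := one_le_pow₀ (by norm_num)
    have hsub : Ioc b (2 * b) ⊆ Ioc (D ^ 2) N := by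
      refine Ioc_subset_Ioc ?_ ?_
      · rw [hb]; exact le_mul_of_one_le_right (by positivity) h4j
      · have : (4 : ℝ) ^ j ≤ 4 ^ J :=
          pow_le_pow_right₀ (by norm_num) (Finset.mem_range.1 hj).le
        calc 2 * b ≤ 2 * (D ^ 2 * 4 ^ J) := by rw [hb]; gcongr
          _ ≤ (2 * π) * (D ^ 2 * 4 ^ J) := by gcongr; linarith [Real.pi_gt_three]
          _ = N := by rw [hN]; ring
    have hnn : ∀ σ, 0 ≤ f j σ := fun σ ↦ by simp only [hf]; positivity
    calc N / 36864 = ∫ _ in Ioc b (2 * b), N / 18 * b * (1 / 4) ^ 2 / (32 * (2 * b) ^ 2) := by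
          rw [setIntegral_const, smul_eq_mul]
          simp only [Measure.real, Real.volume_Ioc]
          rw [ENNReal.toReal_ofReal (by linarith)]
          field_simp
          ring
      _ ≤ ∫ σ in Ioc b (2 * b), f j σ := by
          refine setIntegral_mono_on (integrableOn_const (by simp)) ((hfi j).mono_set hsub)
            measurableSet_Ioc fun σ hσ ↦ ?_
          have hσ0 : 0 < σ := hb0.trans hσ.1
          have hx1 : 1 / 2 ≤ σ / (2 * b) := by
            rw [div_le_div_iff₀ (by norm_num) (by positivity)]; linarith [hσ.1]
          have hx2 : σ / (2 * b) ≤ 1 := by rw [div_le_one (by positivity)]; exact hσ.2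
          have hs : 1 / 4 ≤ sin (σ / (2 * b)) := by
            have := Real.sin_gt_sub_cube (x := σ / (2 * b)) (by positivity)
            have : (σ / (2 * b)) ^ 3 ≤ σ / (2 * b) :=
              pow_le_of_le_one (by positivity) hx2 (by norm_num)
            linarith
          simp only [hf]
          gcongr
          exact hσ.2
      _ ≤ _ := setIntegral_mono_set (hfi j) (.of_forall hnn) (.of_forall hsub)
  calc N * J / 36864 = ∑ _j ∈ Finset.range J, N / 36864 := by
        rw [Finset.sum_const, Finset.card_range, nsmul_eq_mul]; ring
    _ ≤ _ := Finset.sum_le_sum hj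

/-! ### Gaussian-weighted energy of a curve -/

/-- The real part of the Gaussian-regularized Schrödinger kernel, up to the factor `2π`. -/
def gaussKernel (δ σ d : ℝ) : ℝ :=
  exp (-(d ^ 2 / (2 * (δ ^ 2 + σ ^ 2)) * δ)) *
    (δ * cos (d ^ 2 / (2 * (δ ^ 2 + σ ^ 2)) * σ) + σ * sin (d ^ 2 / (2 * (δ ^ 2 + σ ^ 2)) * σ))
      / (δ ^ 2 + σ ^ 2)

theorem gaussKernel_neg (δ σ d : ℝ) : gaussKernel δ (-σ) (-d) = gaussKernel δ σ d := by
  simp [gaussKernel]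

theorem gaussKernel_phase_le {δ σ d : ℝ} (hδ : 0 < δ) (hσ : 0 ≤ σ) (hd : d ^ 2 ≤ σ) :
    d ^ 2 / (2 * (δ ^ 2 + σ ^ 2)) * σ ≤ 1 / 2 := by
  rw [div_mul_eq_mul_div, div_le_div_iff₀ (by positivity) (by norm_num)]
  nlinarith [mul_le_mul_of_nonneg_right hd hσ, sq_nonneg δ]

/-- The Hölder condition `d² ≤ |σ|` keeps the oscillating phase of modulus at most `1/2`, so its
cosine is nonnegative and its sine has the sign of `σ`. -/
theorem gaussKernel_nonneg {δ σ d : ℝ} (hδ : 0 < δ) (hd : d ^ 2 ≤ |σ|) :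
    0 ≤ gaussKernel δ σ d := by
  wlog hσ : 0 ≤ σ generalizing σ d
  · rw [← gaussKernel_neg]
    exact this (by simpa using hd) (by linarith)
  rw [abs_of_nonneg hσ] at hd
  have h1 := gaussKernel_phase_le hδ hσ hd
  have h0 : 0 ≤ d ^ 2 / (2 * (δ ^ 2 + σ ^ 2)) * σ := by positivity
  unfold gaussKernel
  have hc := cos_nonneg_of_neg_pi_div_two_le_of_le
    (by linarith [Real.pi_pos] : -(π / 2) ≤ d ^ 2 / (2 * (δ ^ 2 + σ ^ 2)) * σ)
    (by linarith [Real.pi_gt_three])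
  have hs := sin_nonneg_of_nonneg_of_le_pi h0 (by linarith [Real.pi_gt_three])
  positivity

/-- The cosine term is discarded. The sine is at least half its argument, which is comparable to `d²
/ σ`, and `δ ≤ σ` keeps the exponential above `1/2`. -/
theorem gaussKernel_lower {δ σ d : ℝ} (hδ : 0 < δ) (hδσ : δ ≤ σ) (hd : d ^ 2 ≤ σ) :
    d ^ 2 / (32 * σ ^ 2) ≤ gaussKernel δ σ d := by
  have hσ : 0 < σ := hδ.trans_le hδσ
  have h1 := gaussKernel_phase_le hδ hσ.le hd
  set q := d ^ 2 / (2 * (δ ^ 2 + σ ^ 2)) with hq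
  have hq0 : 0 ≤ q := by positivity
  have h0 : 0 ≤ q * σ := by positivity
  have hc := cos_nonneg_of_neg_pi_div_two_le_of_le
    (by linarith [Real.pi_pos] : -(π / 2) ≤ q * σ) (by linarith [Real.pi_gt_three])
  have hs : q * σ / 2 ≤ sin (q * σ) := by
    rcases h0.eq_or_lt with h | h
    · rw [← h]; simp
    · have h2 := Real.sin_gt_sub_cube h
      have h3 : (q * σ) ^ 3 ≤ q * σ := pow_le_of_le_one h0 (by linarith) (by norm_num)
      linarith
  have he : 1 / 2 ≤ exp (-(q * δ)) := by
    have h2 : q * δ ≤ q * σ := by gcongr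
    linarith [Real.add_one_le_exp (-(q * δ))]
  have hm : δ ^ 2 + σ ^ 2 ≤ 2 * σ ^ 2 := by nlinarith
  have hq2 : d ^ 2 / (4 * σ ^ 2) ≤ q := by
    rw [hq]
    exact div_le_div_of_nonneg_left (by positivity) (by positivity) (by linarith)
  unfold gaussKernel
  rw [← hq]
  calc d ^ 2 / (32 * σ ^ 2) = 1 / 2 * (σ * (d ^ 2 / (4 * σ ^ 2) * σ / 2)) / (2 * σ ^ 2) := by
        field_simp; ring
    _ ≤ exp (-(q * δ)) * (σ * (q * σ / 2)) / (δ ^ 2 + σ ^ 2) := by gcongr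
    _ ≤ _ := by
        gcongr
        nlinarith

/-- The Gaussian frequency weight. -/
def gaussWeight (δ : ℝ) (z : Plane) : ℂ := (exp (-(δ / 2) * ‖z‖ ^ 2) : ℝ)

theorem integrable_exp_neg_mul_norm_sq {b : ℝ} (hb : 0 < b) :
    Integrable fun z : Plane ↦ exp (-b * ‖z‖ ^ 2) := by
  have := (GaussianFourier.integrable_cexp_neg_mul_sq_norm_add (b := b) (by simpa using hb) 0
    (0 : Plane)).norm
  refine this.congr (.of_forall fun z ↦ ?_)
  simp only [zero_mul, add_zero, Complex.norm_exp]
  congr 1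
  norm_cast

theorem integral_exp_neg_mul_norm_sq {b : ℝ} (hb : 0 < b) :
    ∫ z : Plane, exp (-b * ‖z‖ ^ 2) = π / b := by
  have := GaussianFourier.integral_rexp_neg_mul_sq_norm (V := Plane) hb
  simpa using this

theorem integrable_gaussWeight {δ : ℝ} (hδ : 0 < δ) : Integrable (gaussWeight δ) :=
  (integrable_exp_neg_mul_norm_sq (half_pos hδ)).ofReal

/-- Space-time points above a curve `y`, in the frame moving with the central frequency. -/
def framePoint (d σ : ℝ) : Plane × ℝ := (!₂[0, d / (2 * π)], σ / (8 * π ^ 2))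

theorem framePoint_sub (d σ d' σ' : ℝ) :
    framePoint d σ - framePoint d' σ' = framePoint (d - d') (σ - σ') := by
  simp only [framePoint, Prod.mk_sub_mk, Prod.mk.injEq]
  constructor
  · ext i
    fin_cases i <;> simp
    ring
  · ring

theorem continuous_framePoint {y : ℝ → ℝ} (hy : Continuous y) :
    Continuous fun s ↦ framePoint (y s) s := by
  unfold framePoint
  fun_prop

/-- The normalization of `framePoint` makes the phase `d z₂ - σ‖z‖²/2`, so this is a Gaussian
integral with complex parameter `(δ + iσ)/2`. -/
theorem re_waveIntegral_gaussWeight {δ : ℝ} (hδ : 0 < δ) (σ d : ℝ) :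
    (waveIntegral (gaussWeight δ) (framePoint d σ)).re = 2 * π * gaussKernel δ σ d := by
  set b : ℂ := (δ + σ * Complex.I) / 2 with hb
  have hbre : 0 < b.re := by simp [hb]; positivity
  set m : ℝ := δ ^ 2 + σ ^ 2 with hm
  have hm0 : 0 < m := by positivity
  have hmC : (m : ℂ) ≠ 0 := by exact_mod_cast hm0.ne'
  have hA : ((δ : ℂ) + σ * Complex.I) * (δ - σ * Complex.I) = m := by
    rw [hm]; push_cast; ring_nf; rw [Complex.I_sq]; ring
  have hA0 : (δ : ℂ) + σ * Complex.I ≠ 0 := left_ne_zero_of_mul (hA ▸ hmC)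
  have hinv : ((δ : ℂ) + σ * Complex.I)⁻¹ = (δ - σ * Complex.I) / m := by
    rw [eq_div_iff hmC, ← hA, inv_mul_cancel_left₀ hA0]
  have e1 : waveIntegral (gaussWeight δ) (framePoint d σ)
      = ∫ z : Plane, Complex.exp (-b * ‖z‖ ^ 2 + Complex.I * (inner ℝ !₂[0, d] z : ℝ)) := by
    rw [waveIntegral]
    congr 1
    ext z
    have hin : (2 * π * inner ℝ !₂[0, d / (2 * π)] z : ℝ) = inner ℝ (!₂[0, d] : Plane) z := by
      simp [PiLp.inner_apply, Fin.sum_univ_two]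
      field_simp
    rw [wave, gaussWeight, Complex.ofReal_exp, ← Complex.exp_add, wavePhase, framePoint, hin]
    congr 1
    rw [hb]
    push_cast
    field_simp
    ring
  have hn : ‖(!₂[0, d] : Plane)‖ ^ 2 = d ^ 2 := by
    rw [EuclideanSpace.real_norm_sq_eq]; simp [Fin.sum_univ_two]
  rw [e1, GaussianFourier.integral_cexp_neg_mul_sq_norm_add hbre, finrank_euclideanSpace_fin]
  have e2 : ((π : ℂ) / b) ^ (((2 : ℕ) : ℂ) / 2) = (2 * π / m : ℝ) * (δ - σ * Complex.I) := by
    norm_num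
    rw [hb, div_div_eq_mul_div, div_eq_mul_inv, hinv]
    ring
  have e3 : Complex.I ^ 2 * ((‖(!₂[0, d] : Plane)‖ : ℝ) : ℂ) ^ 2 / (4 * b)
      = ((-(d ^ 2 / (2 * m) * δ) : ℝ) : ℂ) + ((d ^ 2 / (2 * m) * σ : ℝ) : ℂ) * Complex.I := by
    rw [← Complex.ofReal_pow, hn, Complex.I_sq, hb,
      show (4 : ℂ) * ((δ + σ * Complex.I) / 2) = 2 * (δ + σ * Complex.I) by ring,
      div_eq_mul_inv, mul_inv, hinv]
    push_cast
    field_simp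
    ring
  rw [e2, e3, Complex.exp_add, Complex.exp_mul_I, ← Complex.ofReal_exp, ← Complex.ofReal_cos,
    ← Complex.ofReal_sin, gaussKernel, ← hm]
  simp [-Complex.ofReal_exp, -Complex.ofReal_cos, -Complex.ofReal_sin]
  field_simp

/-- The superposition of the plane waves over the curve `y` for times in `(0, L]`. -/
def curveWave (y : ℝ → ℝ) (L : ℝ) : Plane → ℂ :=
  superpose (volume.restrict (Ioc 0 L)) (fun s ↦ framePoint (y s) s) fun _ ↦ 1

section curveWave

variable {y : ℝ → ℝ} {L : ℝ}

theorem continuous_curveWave (hy : Continuous y) : Continuous (curveWave y L) :=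
  continuous_superpose (continuous_framePoint hy).measurable (integrable_const _)

theorem norm_curveWave_le (hL : 0 ≤ L) (z : Plane) : ‖curveWave y L z‖ ≤ L := by
  refine norm_superpose_le z |>.trans ?_
  simp [hL]

/-- The `TT*` identity with the Gaussian as multiplier. The left side is real, so only the real part
of the kernel enters. -/
theorem integral_gaussWeight_mul_curveWave (hy : Continuous y) {δ : ℝ} (hδ : 0 < δ) (hL : 0 ≤ L) :
    ∫ z, exp (-(δ / 2) * ‖z‖ ^ 2) * ‖curveWave y L z‖ ^ 2
      = 2 * π * ∫ s in Ioc 0 L, ∫ s' in Ioc 0 L, gaussKernel δ (s' - s) (y s' - y s) := by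
  set μ : Measure ℝ := volume.restrict (Ioc 0 L)
  have hG := integrable_gaussWeight hδ
  have hGV : Integrable fun z ↦ gaussWeight δ z * curveWave y L z :=
    hG.mul_bdd (continuous_curveWave hy).aestronglyMeasurable
      (.of_forall fun z ↦ norm_curveWave_le hL z)
  have hp := (continuous_framePoint hy)
  have h1 := integral_conj_mul_waveIntegral (μ := μ) (g := fun _ ↦ 1) hp.measurable
    (integrable_const _) hGV
  have e0 : ((∫ z, exp (-(δ / 2) * ‖z‖ ^ 2) * ‖curveWave y L z‖ ^ 2 : ℝ) : ℂ)
      = ∫ z, (starRingEnd ℂ) (superpose μ (fun s ↦ framePoint (y s) s) (fun _ ↦ 1) z)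
        * (gaussWeight δ z * curveWave y L z) := by
    rw [← integral_complex_ofReal]
    refine integral_congr_ae (.of_forall fun z ↦ ?_)
    have := RCLike.conj_mul (curveWave y L z)
    change _ = (starRingEnd ℂ) (curveWave y L z) * (gaussWeight δ z * curveWave y L z)
    rw [mul_left_comm, this, gaussWeight]
    push_cast
    rfl
  have e1 : ∀ s, waveIntegral (fun z ↦ gaussWeight δ z * curveWave y L z) (framePoint (y s) s)
      = ∫ s', waveIntegral (gaussWeight δ) (framePoint (y s - y s') (s - s')) ∂μ := by
    intro s
    have := waveIntegral_mul_superpose (μ := μ) (g := fun _ ↦ 1) hp.measurable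
      (integrable_const _) hG (framePoint (y s) s)
    simpa only [framePoint_sub, one_mul] using! this
  simp only [map_one, one_mul, e1] at h1
  rw [← h1] at e0
  have hcont : Continuous fun z : ℝ × ℝ ↦
      waveIntegral (gaussWeight δ) (framePoint (y z.1 - y z.2) (z.1 - z.2)) := by
    refine (continuous_waveIntegral hG).comp ?_
    unfold framePoint
    fun_prop
  have hint : Integrable (fun z : ℝ × ℝ ↦
      waveIntegral (gaussWeight δ) (framePoint (y z.1 - y z.2) (z.1 - z.2))) (μ.prod μ) :=
    Integrable.of_bound hcont.aestronglyMeasurable _ (.of_forall fun z ↦ norm_waveIntegral_le _ _)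
  have e2 := congrArg Complex.re e0
  rw [Complex.ofReal_re] at e2
  rw [e2, ← Complex.reCLM_apply, ← ContinuousLinearMap.integral_comp_comm _ hint.integral_prod_left,
    ← integral_const_mul]
  refine integral_congr_ae ?_
  filter_upwards [hint.prod_right_ae] with s hs
  rw [← ContinuousLinearMap.integral_comp_comm _ hs, ← integral_const_mul]
  refine integral_congr_ae (.of_forall fun s' ↦ ?_)
  simp only [Complex.reCLM_apply]
  rw [re_waveIntegral_gaussWeight hδ, ← gaussKernel_neg, neg_sub, neg_sub]

theorem continuous_gaussKernel_comp (hy : Continuous y) {δ : ℝ} (hδ : 0 < δ) :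
    Continuous fun z : ℝ × ℝ ↦ gaussKernel δ (z.2 - z.1) (y z.2 - y z.1) := by
  unfold gaussKernel
  have h : ∀ z : ℝ × ℝ, δ ^ 2 + (z.2 - z.1) ^ 2 ≠ 0 := fun z ↦ by positivity
  have h' : ∀ z : ℝ × ℝ, 2 * (δ ^ 2 + (z.2 - z.1) ^ 2) ≠ 0 := fun z ↦ by positivity
  fun_prop (disch := assumption)

/-- Nonnegativity of the kernel allows restriction to pairs `(s, s + σ)` with `0 < s ≤ N` and `δ < σ
≤ N`, which lie in the square of side `2N`. On them the pointwise lower bound applies. -/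
theorem integral_gaussKernel_lower (hy : Continuous y) (hyH : ∀ s s', (y s - y s') ^ 2 ≤ |s - s'|) {δ N : ℝ}
    (hδ : 0 < δ) (hN : 0 ≤ N) :
    ∫ σ in Ioc δ N, (∫ s in (0 : ℝ)..N, (y (s + σ) - y s) ^ 2) / (32 * σ ^ 2)
      ≤ ∫ s in Ioc 0 (2 * N), ∫ s' in Ioc 0 (2 * N), gaussKernel δ (s' - s) (y s' - y s) := by
  obtain ⟨K, hK⟩ : ∃ K : ℝ → ℝ → ℝ, ∀ s s', K s s' = gaussKernel δ (s' - s) (y s' - y s) :=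
    ⟨_, fun _ _ ↦ rfl⟩
  simp only [← hK]
  have hKc : Continuous (Function.uncurry K) := by
    simpa only [Function.uncurry_def, hK] using continuous_gaussKernel_comp hy hδ
  have hK0 : ∀ s s', 0 ≤ K s s' := fun s s' ↦ hK s s' ▸ gaussKernel_nonneg hδ (hyH _ _)
  have hKs : ∀ s, Continuous (K s) := fun s ↦ hKc.comp (Continuous.prodMk_right s)
  have hKint : Continuous fun s ↦ ∫ s' in (0 : ℝ)..(2 * N), K s s' :=
    intervalIntegral.continuous_parametric_intervalIntegral_of_continuous' hKc _ _
  have hKint' : Continuous fun s ↦ ∫ s' in Ioc 0 (2 * N), K s s' := by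
    simpa only [intervalIntegral.integral_of_le (by linarith : (0 : ℝ) ≤ 2 * N)] using hKint
  set f : ℝ → ℝ → ℝ := fun s σ ↦ (y (s + σ) - y s) ^ 2 / (32 * σ ^ 2) with hf
  have hfc : ContinuousOn (Function.uncurry f) (Icc 0 N ×ˢ Icc δ N) := by
    refine ContinuousOn.div (by fun_prop) (by fun_prop) fun z hz ↦ ?_
    have : 0 < z.2 := hδ.trans_le hz.2.1
    positivity
  have hfi : Integrable (Function.uncurry f)
      ((volume.restrict (Ioc 0 N)).prod (volume.restrict (Ioc δ N))) := by
    rw [Measure.prod_restrict]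
    exact (hfc.integrableOn_compact (isCompact_Icc.prod isCompact_Icc)).mono_set
      (prod_mono Ioc_subset_Icc_self Ioc_subset_Icc_self)
  have hinner : ∀ s ∈ Ioc 0 N, ∫ σ in Ioc δ N, f s σ ≤ ∫ s' in Ioc 0 (2 * N), K s s' := by
    intro s hs
    rcases lt_or_ge N δ with h | h
    · rw [Ioc_eq_empty (by linarith), setIntegral_empty]
      exact integral_nonneg fun s' ↦ hK0 s s'
    have hshift : ∫ σ in Ioc δ N, K s (s + σ) = ∫ s' in Ioc (s + δ) (s + N), K s s' := by
      rw [← intervalIntegral.integral_of_le h, ← intervalIntegral.integral_of_le (by linarith),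
        intervalIntegral.integral_comp_add_left (K s) s]
    calc ∫ σ in Ioc δ N, f s σ ≤ ∫ σ in Ioc δ N, K s (s + σ) := by
          refine setIntegral_mono_on ?_ ?_ measurableSet_Ioc fun σ hσ ↦ ?_
          · refine IntegrableOn.mono_set (ContinuousOn.integrableOn_Icc ?_) Ioc_subset_Icc_self
            refine ContinuousOn.div (by fun_prop) (by fun_prop) fun σ hσ ↦ ?_
            have : 0 < σ := hδ.trans_le hσ.1
            positivity
          · exact ((hKs s).comp (continuous_const.add continuous_id)).integrableOn_Ioc
          · have h1 := hyH (s + σ) s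
            rw [add_sub_cancel_left, abs_of_pos (hδ.trans hσ.1)] at h1
            have := gaussKernel_lower hδ hσ.1.le h1
            simpa only [hK, hf, add_sub_cancel_left] using this
      _ = ∫ s' in Ioc (s + δ) (s + N), K s s' := hshift
      _ ≤ _ := setIntegral_mono_set (hKs s).integrableOn_Ioc (.of_forall fun s' ↦ hK0 s s')
          (.of_forall (Ioc_subset_Ioc (by linarith [hs.1]) (by linarith [hs.2])))
  calc _ = ∫ σ in Ioc δ N, ∫ s in Ioc 0 N, f s σ := by
        refine integral_congr_ae (.of_forall fun σ ↦ ?_)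
        simp only [hf, intervalIntegral.integral_of_le hN, integral_div]
    _ = ∫ s in Ioc 0 N, ∫ σ in Ioc δ N, f s σ := (integral_integral_swap hfi).symm
    _ ≤ ∫ s in Ioc 0 N, ∫ s' in Ioc 0 (2 * N), K s s' :=
        setIntegral_mono_on hfi.integral_prod_left hKint'.integrableOn_Ioc measurableSet_Ioc hinner
    _ ≤ _ := setIntegral_mono_set hKint'.integrableOn_Ioc
          (.of_forall fun s ↦ integral_nonneg fun s' ↦ hK0 s s')
          (.of_forall (Ioc_subset_Ioc le_rfl (by linarith)))

end curveWave

/-- The energy of a curve wave concentrates at low frequencies up to an exponentially small error. -/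
theorem integral_ball_curveWave_lower {y : ℝ → ℝ} (hy : Continuous y) {L δ : ℝ} (hδ : 0 < δ)
    (hL : 0 ≤ L) :
    (∫ z, exp (-(δ / 2) * ‖z‖ ^ 2) * ‖curveWave y L z‖ ^ 2)
      - L ^ 2 * exp (-δ / 400) * (4 * π / δ)
      ≤ ∫ z in Metric.closedBall (0 : Plane) (1 / 10), ‖curveWave y L z‖ ^ 2 := by
  have hVc := continuous_curveWave hy (L := L)
  have hVL := norm_curveWave_le (y := y) hL
  have i1 : Integrable fun z ↦ exp (-(δ / 2) * ‖z‖ ^ 2) * ‖curveWave y L z‖ ^ 2 := by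
    refine (integrable_exp_neg_mul_norm_sq (half_pos hδ)).mul_bdd (c := L ^ 2)
      (hVc.norm.pow 2).aestronglyMeasurable (.of_forall fun z ↦ ?_)
    rw [norm_pow, norm_norm]
    gcongr
    exact hVL z
  have i2 : Integrable fun z : Plane ↦ L ^ 2 * exp (-δ / 400) * exp (-(δ / 4) * ‖z‖ ^ 2) :=
    (integrable_exp_neg_mul_norm_sq (by positivity)).const_mul _
  have i3 : Integrable ((Metric.closedBall (0 : Plane) (1 / 10)).indicator
      fun z ↦ ‖curveWave y L z‖ ^ 2) :=
    ((hVc.norm.pow 2).continuousOn.integrableOn_compact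
      (isCompact_closedBall _ _)).integrable_indicator Metric.isClosed_closedBall.measurableSet
  have e : L ^ 2 * exp (-δ / 400) * (4 * π / δ)
      = ∫ z : Plane, L ^ 2 * exp (-δ / 400) * exp (-(δ / 4) * ‖z‖ ^ 2) := by
    rw [integral_const_mul, integral_exp_neg_mul_norm_sq (by positivity)]
    field_simp
  rw [e, ← integral_sub i1 i2, ← integral_indicator Metric.isClosed_closedBall.measurableSet]
  refine integral_mono (i1.sub i2) i3 fun z ↦ ?_
  simp only
  by_cases hz : z ∈ Metric.closedBall (0 : Plane) (1 / 10)
  · rw [indicator_of_mem hz]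
    have h1 : exp (-(δ / 2) * ‖z‖ ^ 2) ≤ 1 := by
      rw [Real.exp_le_one_iff]
      have : 0 ≤ δ / 2 * ‖z‖ ^ 2 := by positivity
      linarith
    have h2 : 0 ≤ L ^ 2 * exp (-δ / 400) * exp (-(δ / 4) * ‖z‖ ^ 2) := by positivity
    have h3 := mul_le_of_le_one_left (sq_nonneg ‖curveWave y L z‖) h1
    linarith
  · rw [indicator_of_notMem hz]
    have hz' : 1 / 10 < ‖z‖ := by simpa using hz
    -- Half of the Gaussian exponent yields the small factor outside the ball, since `(δ / 4) (1 /
    -- 10)² = δ / 400`; the other half keeps the tail integrable.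
    have h1 : exp (-(δ / 2) * ‖z‖ ^ 2) ≤ exp (-δ / 400) * exp (-(δ / 4) * ‖z‖ ^ 2) := by
      rw [← Real.exp_add, Real.exp_le_exp]
      have hz2 : (1 / 10) ^ 2 ≤ ‖z‖ ^ 2 := by gcongr
      nlinarith
    have h2 : ‖curveWave y L z‖ ^ 2 ≤ L ^ 2 := by gcongr; exact hVL z
    have h3 : exp (-(δ / 2) * ‖z‖ ^ 2) * ‖curveWave y L z‖ ^ 2
        ≤ exp (-δ / 400) * exp (-(δ / 4) * ‖z‖ ^ 2) * L ^ 2 := by gcongr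
    linarith

/-- The order of choices matters: `J` is fixed first, large enough to beat `B`. Then `D` is taken so
large, with `δ = D²`, that the tail outside the ball costs less than `N`, although its bound
contains `4 ^ J`. -/
theorem exists_curveWave_large (B : ℝ) : ∃ (y : ℝ → ℝ) (L : ℝ), Continuous y ∧ 0 < L ∧
    B * L < ∫ z in Metric.closedBall (0 : Plane) (1 / 10), ‖curveWave y L z‖ ^ 2 := by
  obtain ⟨J, hJ⟩ := exists_nat_gt ((2 * B + 1) * 36864 / (2 * π))
  have hJ' : 2 * B + 1 < 2 * π * J / 36864 := by
    rw [div_lt_iff₀ (by positivity)] at hJ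
    rw [lt_div_iff₀ (by norm_num)]
    linarith
  have hlim : Filter.Tendsto (fun D : ℝ ↦ 32 * π ^ 2 * 4 ^ J * exp (-D ^ 2 / 400))
      Filter.atTop (nhds (32 * π ^ 2 * 4 ^ J * 0)) := by
    refine Filter.Tendsto.const_mul _ ?_
    refine Real.tendsto_exp_atBot.comp ?_
    simp only [neg_div]
    exact Filter.tendsto_neg_atTop_atBot.comp
      ((Filter.tendsto_pow_atTop two_ne_zero).atTop_div_const (by norm_num))
  rw [mul_zero] at hlim
  obtain ⟨D, hD1, hD⟩ := ((hlim.eventually_lt_const zero_lt_one).and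
    (Filter.eventually_gt_atTop 0)).exists
  set N : ℝ := 2 * π * D ^ 2 * 4 ^ J with hN
  have hN0 : 0 < N := by positivity
  have hδ : 0 < D ^ 2 := by positivity
  have hy := continuous_lacunary J D
  refine ⟨lacunary J D, 2 * N, hy, by positivity, ?_⟩
  have h1 := integral_ball_curveWave_lower hy (L := 2 * N) hδ (by positivity)
  rw [integral_gaussWeight_mul_curveWave hy hδ (by positivity)] at h1
  have h2 := integral_gaussKernel_lower hy (lacunary_sub_sq_le J hD) hδ hN0.le
  have h3 := integral_lacunary_lower J hD
  rw [← hN] at h3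
  have h4 : (2 * N) ^ 2 * exp (-D ^ 2 / 400) * (4 * π / D ^ 2)
      = N * (32 * π ^ 2 * 4 ^ J * exp (-D ^ 2 / 400)) := by
    rw [hN]; field_simp; ring
  rw [h4] at h1
  have h5 : N * (32 * π ^ 2 * 4 ^ J * exp (-D ^ 2 / 400)) < N * 1 := by gcongr
  have h6 : N * (2 * B + 1) < N * (2 * π * J / 36864) := by gcongr
  have h7 := mul_le_mul_of_nonneg_left (h3.trans h2) (by positivity : 0 ≤ 2 * π)
  have h8 : 2 * π * (N * J / 36864) = N * (2 * π * J / 36864) := by ring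
  linarith

/-! ### Failure of the estimate without angular averaging -/

/-- A curve is a null set, so continuity is needed to make the essential supremum control values
along it. -/
theorem enorm_le_eLpNorm_top {α : Type*} [TopologicalSpace α] [MeasurableSpace α]
    [OpensMeasurableSpace α] {μ : Measure α} [μ.IsOpenPosMeasure] {f : α → ℂ} (hf : Continuous f)
    (x : α) : ‖f x‖ₑ ≤ eLpNorm f ∞ μ := by
  rw [eLpNorm_exponent_top]
  have hc : IsClosed {x | ‖f x‖ₑ ≤ eLpNormEssSup f μ} := isClosed_le hf.enorm continuous_const
  have hae : {x | ‖f x‖ₑ ≤ eLpNormEssSup f μ} =ᵐ[μ] univ :=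
    Filter.eventuallyEq_univ.2 (ae_le_eLpNormEssSup (f := f) (μ := μ))
  have := hc.ae_eq_univ_iff_eq.1 hae
  exact eq_univ_iff_forall.1 this x

theorem lpSymbol_eq_one (η : LPBump) (k : ℤ) {ξ : Plane} (h1 : 9 / 10 * 2 ^ k ≤ 2 * π * ‖ξ‖)
    (h2 : 2 * π * ‖ξ‖ ≤ 11 / 10 * 2 ^ k) : lpSymbol η k ξ = 1 := by
  have hl : (0 : ℝ) < 2 ^ k := by positivity
  have a : 2 * π * ‖ξ‖ / 2 ^ k ≤ 11 / 10 := by rwa [div_le_iff₀ hl]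
  have b : 9 / 5 ≤ 2 * π * ‖ξ‖ / 2 ^ (k - 1) := by
    rw [zpow_sub_one₀ two_ne_zero, le_div_iff₀ (by positivity)]
    linarith
  have n : 0 ≤ 2 * π * ‖ξ‖ / 2 ^ k := by positivity
  rw [lpSymbol, LPBump.chi, η.eq_one _ (by rw [abs_of_nonneg n]; linarith),
    η.eq_zero _ (by rw [abs_of_nonneg (by linarith)]; linarith)]
  simp

/-- The space-time curve `x = (s, y(s)) / l`, `t = s / (2 l²)`. -/
def curvePoint (y : ℝ → ℝ) (l s : ℝ) : Plane × ℝ := (!₂[s / l, y s / l], s / (2 * l ^ 2))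

theorem continuous_curvePoint {y : ℝ → ℝ} (hy : Continuous y) (l : ℝ) :
    Continuous (curvePoint y l) := by
  unfold curvePoint
  fun_prop

/-- The superposition of the plane waves over a space-time curve, with the phase of the
central frequency. -/
def modulatedCurveWave (y : ℝ → ℝ) (L l : ℝ) : Plane → ℂ :=
  superpose (volume.restrict (Ioc 0 L)) (curvePoint y l)
    fun s ↦ Complex.exp ((s / 2 : ℝ) * Complex.I)

/-- Galilean change of frame: the curve travels at the group velocity of the central frequency, so
the terms linear in `z 0` cancel. What remains is the scalar phase `s / 2`, removed by the
modulation. -/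
theorem modulatedCurveWave_eq (y : ℝ → ℝ) (L : ℝ) {l : ℝ} (hl : 0 < l) (z : Plane) :
    modulatedCurveWave y L l ((l / (2 * π)) • (z + !₂[1, 0])) = curveWave y L z := by
  refine integral_congr_ae (.of_forall fun s ↦ ?_)
  have hw : wave (curvePoint y l s) ((l / (2 * π)) • (z + !₂[1, 0]))
      = Complex.exp ((s / 2 : ℝ) * Complex.I) * wave (framePoint (y s) s) z := by
    rw [wave, wave, ← Complex.exp_add, ← add_mul, ← Complex.ofReal_add]
    congr 3
    simp only [wavePhase, curvePoint, framePoint, norm_smul, mul_pow, norm_eq_abs, sq_abs,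
      EuclideanSpace.real_norm_sq_eq, PiLp.inner_apply, Fin.sum_univ_two, PiLp.smul_apply,
      PiLp.add_apply]
    simp
    field_simp
    ring
  simp only [hw, map_mul, ← mul_assoc, Complex.mul_conj, Complex.normSq_eq_norm_sq,
    Complex.norm_exp_ofReal_mul_I]
  simp

theorem integral_closedBall_modulatedCurveWave (y : ℝ → ℝ) (L : ℝ) {l : ℝ} (hl : 0 < l) :
    ∫ ξ in Metric.closedBall ((l / (2 * π)) • (!₂[1, 0] : Plane)) (l / (2 * π) / 10),
        ‖modulatedCurveWave y L l ξ‖ ^ 2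
      = (l / (2 * π)) ^ 2 *
        ∫ z in Metric.closedBall (0 : Plane) (1 / 10), ‖curveWave y L z‖ ^ 2 := by
  set c := l / (2 * π) with hc
  have hc0 : 0 < c := by positivity
  rw [← integral_indicator Metric.isClosed_closedBall.measurableSet,
    ← integral_indicator Metric.isClosed_closedBall.measurableSet]
  set F := (Metric.closedBall (c • (!₂[1, 0] : Plane)) (c / 10)).indicator
    fun ξ ↦ ‖modulatedCurveWave y L l ξ‖ ^ 2 with hF
  have h1 := Measure.integral_comp_smul (volume : Measure Plane) F c
  rw [finrank_euclideanSpace_fin, abs_of_pos (by positivity), smul_eq_mul] at h1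
  have h2 := integral_add_right_eq_self (μ := (volume : Measure Plane))
    (fun ζ ↦ F (c • ζ)) !₂[1, 0]
  have h3 : ∀ z : Plane, F (c • (z + !₂[1, 0]))
      = (Metric.closedBall (0 : Plane) (1 / 10)).indicator (fun z ↦ ‖curveWave y L z‖ ^ 2) z := by
    intro z
    have hmem : c • (z + !₂[1, 0]) ∈ Metric.closedBall (c • (!₂[1, 0] : Plane)) (c / 10)
        ↔ z ∈ Metric.closedBall (0 : Plane) (1 / 10) := by
      rw [mem_closedBall_iff_norm, mem_closedBall_zero_iff, ← smul_sub, add_sub_cancel_right,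
        norm_smul, norm_of_nonneg hc0.le, ← mul_one_div, mul_le_mul_iff_right₀ hc0]
    by_cases hz : z ∈ Metric.closedBall (0 : Plane) (1 / 10)
    · rw [indicator_of_mem hz, hF, indicator_of_mem (hmem.2 hz), hc, modulatedCurveWave_eq y L hl]
    · rw [indicator_of_notMem hz, hF, indicator_of_notMem (mt hmem.1 hz)]
  simp only [h3] at h2
  rw [h2, h1]
  field_simp

theorem norm_sq_toLp {f : Plane → ℂ} (hf : MemLp f 2) : ‖hf.toLp f‖ ^ 2 = ∫ ξ, ‖f ξ‖ ^ 2 := by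
  have h := L2.inner_def (𝕜 := ℂ) (hf.toLp f) (hf.toLp f)
  rw [inner_self_eq_norm_sq_to_K] at h
  have e : ∫ ξ, inner ℂ (hf.toLp f ξ) (hf.toLp f ξ) = ((∫ ξ, ‖f ξ‖ ^ 2 : ℝ) : ℂ) := by
    rw [← integral_complex_ofReal]
    refine integral_congr_ae ?_
    filter_upwards [hf.coeFn_toLp] with ξ hξ
    rw [hξ, inner_self_eq_norm_sq_to_K]
    push_cast
    rfl
  rw [e] at h
  apply Complex.ofReal_injective
  rw [← h]
  push_cast
  rfl

/-- Sampling a continuous evolution along a space-time curve bounds the maximal norm from below. -/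
theorem ofReal_integral_curve_le_anisotropicNorm_sq {F : Plane → ℝ → ℂ} {u : Plane × ℝ → ℂ}
    (hF : ∀ x t, F x t = u (x, t)) (hu : Continuous u) {y : ℝ → ℝ} (hy : Continuous y)
    {l L : ℝ} (hl : 0 < l) (hL : 0 ≤ L) :
    ENNReal.ofReal (l⁻¹ * ∫ s in Ioc 0 L, ‖u (curvePoint y l s)‖ ^ 2)
      ≤ anisotropicNorm 2 ∞ F ^ 2 := by
  have hpc : Continuous fun s ↦ ‖u (curvePoint y l s)‖ ^ 2 :=
    (hu.comp (continuous_curvePoint hy l)).norm.pow 2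
  have hpc' : Continuous fun x₁ ↦ ‖u (curvePoint y l (l * x₁))‖ ^ 2 :=
    hpc.comp (continuous_const.mul continuous_id)
  have e : l⁻¹ * ∫ s in Ioc 0 L, ‖u (curvePoint y l s)‖ ^ 2
      = ∫ x₁ in Ioc 0 (L / l), ‖u (curvePoint y l (l * x₁))‖ ^ 2 := by
    rw [← intervalIntegral.integral_of_le hL, ← intervalIntegral.integral_of_le (by positivity),
      intervalIntegral.integral_comp_mul_left (fun s ↦ ‖u (curvePoint y l s)‖ ^ 2) hl.ne',
      mul_zero, mul_div_cancel₀ L hl.ne', smul_eq_mul]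
  rw [e, ofReal_integral_eq_lintegral_ofReal hpc'.integrableOn_Ioc
    (.of_forall fun _ ↦ by positivity), anisotropicNorm, eLpNorm_two_sq]
  refine (setLIntegral_le_lintegral _ _).trans (lintegral_mono fun x₁ ↦ ?_)
  have hcont : Continuous fun z : ℝ × ℝ ↦ F !₂[x₁, z.1] z.2 := by
    simp only [hF]
    fun_prop
  have h := enorm_le_eLpNorm_top (μ := volume) hcont (y (l * x₁) / l, l * x₁ / (2 * l ^ 2))
  rw [enorm_eq_self, ENNReal.ofReal_pow (norm_nonneg _), ofReal_norm]
  gcongr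
  refine le_trans (le_of_eq ?_) h
  simp only [hF, curvePoint]
  rw [mul_div_cancel_left₀ x₁ hl.ne']

/-- The datum is the extremizer suggested by duality: its Fourier transform is the superposed wave
cut off to a ball where the symbol is one. With `M` its squared norm, Cauchy–Schwarz gives a squared
maximal norm at least `M² / (l L)`, and `M / (l² L)` can be made larger than `C²`. -/
theorem exists_maximal_estimate_failure (η : LPBump) (k : ℤ) (C : ℝ) : ∃ u₀ : L2Plane,
    ENNReal.ofReal (C * (2 : ℝ) ^ ((k : ℝ) / 2) * ‖u₀‖)
      < anisotropicNorm 2 ∞ (freeEvolution η k u₀) := by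
  obtain ⟨y, L, hy, hL, hlarge⟩ := exists_curveWave_large ((2 * π) ^ 2 * (C ^ 2 + 1))
  set l : ℝ := 2 ^ k with hl_def
  have hl : 0 < l := by positivity
  set c := l / (2 * π) with hc
  have hc0 : 0 < c := by positivity
  set S := Metric.closedBall (c • (!₂[1, 0] : Plane)) (c / 10) with hS
  have hSm : MeasurableSet S := Metric.isClosed_closedBall.measurableSet
  set V := modulatedCurveWave y L l
  set μ : Measure ℝ := volume.restrict (Ioc 0 L)
  set g : ℝ → ℂ := fun s ↦ Complex.exp ((s / 2 : ℝ) * Complex.I) with hg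
  have hgc : Continuous g := by fun_prop
  have hgi : Integrable g μ := hgc.integrableOn_Ioc
  have hp := continuous_curvePoint hy l
  have hVc : Continuous V := continuous_superpose hp.measurable hgi
  have hfm : MemLp (S.indicator V) 2 := by
    rw [memLp_indicator_iff_restrict hSm]
    have : IsFiniteMeasure (volume.restrict S) :=
      ⟨by simpa using (isCompact_closedBall _ _).measure_lt_top⟩
    obtain ⟨B, hB⟩ := (isCompact_closedBall (c • (!₂[1, 0] : Plane)) (c / 10)).exists_bound_of_continuousOn
      hVc.continuousOn
    exact MemLp.of_bound hVc.aestronglyMeasurable B (ae_restrict_of_forall_mem hSm hB)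
  set h : L2Plane := hfm.toLp _ with hh
  set u := localizedWave η k h with hu
  have huc : Continuous u := continuous_localizedWave η k h
  set M := ∫ ξ in S, ‖V ξ‖ ^ 2 with hM
  have hMlow : l ^ 2 * (C ^ 2 + 1) * L < M := by
    rw [hM, integral_closedBall_modulatedCurveWave y L hl]
    calc l ^ 2 * (C ^ 2 + 1) * L = (l / (2 * π)) ^ 2 * ((2 * π) ^ 2 * (C ^ 2 + 1) * L) := by
          field_simp
      _ < _ := by gcongr
  have hM0 : 0 < M := lt_of_le_of_lt (by positivity) hMlow
  have hnorm : ‖h‖ ^ 2 = M := by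
    rw [hh, norm_sq_toLp, hM, ← integral_indicator hSm]
    refine integral_congr_ae (.of_forall fun ξ ↦ ?_)
    by_cases hξ : ξ ∈ S <;> simp [hξ]
  have hone : ∀ ξ ∈ S, lpSymbol η k ξ = 1 := by
    intro ξ hξ
    have hn : ‖c • (!₂[1, 0] : Plane)‖ = c := by
      rw [norm_smul, norm_of_nonneg hc0.le, EuclideanSpace.norm_eq]
      simp [Fin.sum_univ_two]
    have h1 := abs_le.1 ((abs_norm_sub_norm_le ξ (c • (!₂[1, 0] : Plane))).trans
      (mem_closedBall_iff_norm.1 hξ))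
    rw [hn] at h1
    have hcl : 2 * π * c = l := by rw [hc]; field_simp
    have hpi := Real.pi_pos
    apply lpSymbol_eq_one
    · rw [← hl_def, ← hcl]; nlinarith
    · rw [← hl_def, ← hcl]; nlinarith
  -- Pairing the samples with the modulation returns the full energy `M`, because the symbol is one
  -- on `S`.
  have hdual : ∫ s, (starRingEnd ℂ) (g s) * u (curvePoint y l s) ∂μ = (M : ℂ) := by
    rw [hu, localizedWave, integral_conj_mul_waveIntegral hp.measurable hgi
      (integrable_lpSymbol_mul η k h), hM, ← integral_indicator hSm, ← integral_complex_ofReal]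
    refine integral_congr_ae ?_
    filter_upwards [hfm.coeFn_toLp] with ξ hξ
    change (starRingEnd ℂ) (V ξ) * _ = _
    rw [hξ]
    by_cases hS : ξ ∈ S
    · rw [indicator_of_mem hS, indicator_of_mem hS, hone ξ hS, one_mul, RCLike.conj_mul]
      push_cast
      rfl
    · simp [indicator_of_notMem hS]
  have hMle : M ≤ ∫ s, ‖u (curvePoint y l s)‖ ∂μ := by
    have := norm_integral_le_integral_norm (μ := μ)
      (fun s ↦ (starRingEnd ℂ) (g s) * u (curvePoint y l s))
    rw [hdual, Complex.norm_real, norm_of_nonneg hM0.le] at this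
    refine this.trans_eq (integral_congr_ae (.of_forall fun s ↦ ?_))
    simp only [norm_mul, RCLike.norm_conj, hg, Complex.norm_exp_ofReal_mul_I, one_mul]
  have hCS : M ^ 2 ≤ L * ∫ s in Ioc 0 L, ‖u (curvePoint y l s)‖ ^ 2 := by
    have hμ : μ.real univ = L := by simp [μ, hL.le]
    have hc1 : Continuous fun s ↦ ‖u (curvePoint y l s)‖ := (huc.comp hp).norm
    have := sq_integral_le (μ := μ) (by rw [hμ]; exact hL) (hc1.integrableOn_Ioc)
      ((hc1.pow 2).integrableOn_Ioc)
    rw [hμ] at this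
    exact le_trans (by gcongr) this
  refine ⟨𝓕⁻ h, ?_⟩
  have hFh : (𝓕 (𝓕⁻ h : L2Plane) : L2Plane) = h := FourierTransform.fourier_fourierInv_eq h
  have hn0 : ‖(𝓕⁻ h : L2Plane)‖ = ‖h‖ := by rw [← Lp.norm_fourier_eq, hFh]
  have hF : ∀ x t, freeEvolution η k (𝓕⁻ h) x t = u (x, t) := by
    intro x t
    rw [freeEvolution_eq_waveIntegral, hFh]
    rfl
  have hlow := ofReal_integral_curve_le_anisotropicNorm_sq hF huc hy hl hL.le
  have hpow : ((2 : ℝ) ^ ((k : ℝ) / 2)) ^ 2 = l := by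
    rw [← Real.rpow_natCast, ← Real.rpow_mul (by norm_num), hl_def, ← Real.rpow_intCast]
    simp
  have hlt : (|C| * (2 : ℝ) ^ ((k : ℝ) / 2) * ‖h‖) ^ 2
      < l⁻¹ * ∫ s in Ioc 0 L, ‖u (curvePoint y l s)‖ ^ 2 := by
    rw [mul_pow, mul_pow, hpow, hnorm, sq_abs, inv_mul_eq_div, lt_div_iff₀ hl]
    refine lt_of_mul_lt_mul_left (lt_of_lt_of_le ?_ hCS) hL.le
    have : L * (C ^ 2 * l * M * l) ≤ (l ^ 2 * (C ^ 2 + 1) * L) * M := by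
      have : 0 ≤ l ^ 2 * L * M := by positivity
      nlinarith
    refine this.trans_lt ?_
    rw [sq M]
    exact mul_lt_mul_of_pos_right hMlow hM0
  rw [hn0]
  -- `C` may be negative, and squaring is monotone only for the bound with `|C|`.
  have hstep : ENNReal.ofReal (C * (2 : ℝ) ^ ((k : ℝ) / 2) * ‖h‖)
      ≤ ENNReal.ofReal (|C| * (2 : ℝ) ^ ((k : ℝ) / 2) * ‖h‖) := by
    gcongr
    exact le_abs_self C
  refine hstep.trans_lt ?_
  have hsq : ENNReal.ofReal (|C| * (2 : ℝ) ^ ((k : ℝ) / 2) * ‖h‖) ^ 2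
      < anisotropicNorm 2 ∞ (freeEvolution η k (𝓕⁻ h)) ^ 2 := by
    refine lt_of_lt_of_le ?_ hlow
    rw [← ENNReal.ofReal_pow (by positivity)]
    exact (ENNReal.ofReal_lt_ofReal_iff_of_nonneg (by positivity)).2 hlt
  exact lt_of_not_ge fun hge ↦ hsq.not_ge (by gcongr)

end

theorem theorem1p1 (η : LPBump) :
    (∃ C : ℝ, 0 < C ∧ ∀ (k : ℤ) (u₀ : L2Plane),
      anisotropicNorm 2 ∞ (angularNorm 2 (freeEvolution η k u₀))
        ≤ ENNReal.ofReal (C * (2 : ℝ) ^ ((k : ℝ) / 2) * ‖u₀‖)) ∧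
    (∀ (k : ℤ) (C : ℝ), ∃ u₀ : L2Plane,
      ENNReal.ofReal (C * (2 : ℝ) ^ ((k : ℝ) / 2) * ‖u₀‖)
        < anisotropicNorm 2 ∞ (freeEvolution η k u₀)) := by
  exact ⟨exists_angular_maximal_estimate η, exists_maximal_estimate_failure η⟩
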